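/- Let $\mathbb K$ be a field, $n\ge 0$ and $a_1,\dots,a_n$ positive integers, let $R=\mathbb K[x_{i_1,\dots,i_n} : 1\le i_j\le a_j]$, and let $A=(x_{i_1,\dots,i_n})$ be the generic $a_1\times\dots\times a_n$ table. For $J\subseteq\{1,\dots,n\}$ let $A_J$ be the $J$-margin of $A$, i.e. the table indexed by $(i_j)_{j\in J}$ whose entries are obtained from $A$ by summing over all indices outside $J$. Let $L_J\subseteq R$ be the ideal generated by the entries of $A_J$, and let $I(A_J)\subseteq R$ be the ideal generated by the generalized $2\times 2$ minors of $A_J$, i.e. by all elements $b_pb_q-b_{p'}b_{q'}$, where $b$ denotes entries of $A_J$ and $p',q'$ arise from the multi-indices $p,q$ by exchanging one coordinate. For a collection $\Delta$ of subsets of $\{1,\dots,n\}$ put $I_\Delta=\sum_{J\in\Delta}I(A_J)$. Let $S_\Delta$ be the polynomial ring over $\mathbb K$ with one variable for each entry of each margin $A_J$, $J\in\Delta$, let $\tau_\Delta:S_\Delta\to R$ send each variable to the corresponding margin entry, and let $\sigma_\Delta$ be the composite of $\tau_\Delta$ with the Segre map $R\to\mathbb K[y_{j,i} : 1\le j\le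 n,\ 1\le i\le a_j]$, $x_{i_1,\dots,i_n}\mapsto\prod_j y_{j,i_j}$. Let $P_\Delta\subseteq R$ be the ideal generated by $\tau_\Delta(\ker\sigma_\Delta)$. For $j\in\{1,\dots,n\}$ let $\Delta(j)=\{J\in\Delta : j\in J\}$. Let $\Delta$ be a graph, i.e. a simplicial complex on vertices among $\{1,\dots,n\}$ all of whose facets have exactly two elements (they are the edges). Then every minimal prime of $I_\Delta$ is either $P_\Delta$ or of the form $$I_\Delta+\sum_{j\notin\Gamma}P_{\Delta(j)}+\sum_{j\in\Gamma}L_{\{j\}}$$ for some vertex cover $\Gamma\subseteq\{1,\dots,n\}$ of $\Delta$, i.e. a set that meets every edge. -/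

import Mathlib

namespace MarginTable

noncomputable section

/-- The margin over `J` of an `n`-dimensional table `B` of size `a 0 × ⋯ × a (n-1)`: the entry at `i`
is the sum of all entries of `B` whose `j`-th index is `i j` for every `j ∈ J`. -/
def margin {n : ℕ} {a : Fin n → ℕ} {R : Type*} [AddCommMonoid R]
    (B : (∀ j, Fin (a j)) → R) (J : Finset (Fin n)) (i : ∀ j : J, Fin (a j)) : R :=
  ∑ k : (∀ j, Fin (a j)) with ∀ j : J, k j = i j, B k

/-- The ideal generated by the generalized `2 × 2` minors (exchanges of one coordinate) of a
multi-way table. -/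
def segreIdeal {ι : Type*} [DecidableEq ι] {c : ι → ℕ} {R : Type*} [CommRing R]
    (B : (∀ j, Fin (c j)) → R) : Ideal R :=
  Ideal.span {f | ∃ (p q : ∀ j, Fin (c j)) (l : ι),
    f = Matrix.det !![B p, B (Function.update q l (p l));
                      B (Function.update p l (q l)), B q]}

/-- The coordinate ring `𝕂[x_{i₁,…,iₙ}]` of tables. -/
abbrev TableRing (K : Type*) [CommSemiring K] {n : ℕ} (a : Fin n → ℕ) : Type _ :=
  MvPolynomial (∀ j, Fin (a j)) K

/-- The generic table `A = (x_{i₁,…,iₙ})`. -/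
def genericTable (K : Type*) [CommSemiring K] {n : ℕ} (a : Fin n → ℕ) :
    (∀ j, Fin (a j)) → TableRing K a :=
  fun i => MvPolynomial.X i

/-- `I_Δ`: the sum over `J ∈ Δ` of the ideals of generalized `2 × 2` minors of the margins `A_J`. -/
def independenceIdeal (K : Type*) [Field K] {n : ℕ} (a : Fin n → ℕ) (Δ : Set (Finset (Fin n))) :
    Ideal (TableRing K a) :=
  ⨆ J ∈ Δ, segreIdeal (c := fun j : J => a j) (margin (genericTable K a) J)

/-- `L_J`: the ideal generated by the entries of the margin `A_J`. -/
def marginIdeal (K : Type*) [Field K] {n : ℕ} (a : Fin n → ℕ) (J : Finset (Fin n)) :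
    Ideal (TableRing K a) :=
  Ideal.span (Set.range (margin (genericTable K a) J))

/-- `S_Δ`: the polynomial ring with one formal variable for each entry of each margin `A_J`,
`J ∈ Δ`. -/
abbrev MarginRing (K : Type*) [CommSemiring K] {n : ℕ} (a : Fin n → ℕ)
    (Δ : Set (Finset (Fin n))) : Type _ :=
  MvPolynomial (Σ J : Δ, ∀ j : J.1, Fin (a j)) K

/-- `τ_Δ : S_Δ → R` sends each formal variable to the corresponding margin entry. -/
def tau (K : Type*) [Field K] {n : ℕ} (a : Fin n → ℕ) (Δ : Set (Finset (Fin n))) :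
    MarginRing K a Δ →ₐ[K] TableRing K a :=
  MvPolynomial.aeval fun v => margin (genericTable K a) v.1.1 v.2

/-- The Segre parametrization `x_{i₁,…,iₙ} ↦ ∏ⱼ y_{j,iⱼ}`. -/
def segreMap (K : Type*) [Field K] {n : ℕ} (a : Fin n → ℕ) :
    TableRing K a →ₐ[K] MvPolynomial (Σ j : Fin n, Fin (a j)) K :=
  MvPolynomial.aeval fun i => ∏ j, MvPolynomial.X ⟨j, i j⟩

/-- `σ_Δ : S_Δ → 𝕂[y]`, the composite of `τ_Δ` and the Segre parametrization. -/
def sigma (K : Type*) [Field K] {n : ℕ} (a : Fin n → ℕ) (Δ : Set (Finset (Fin n))) :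
    MarginRing K a Δ →ₐ[K] MvPolynomial (Σ j : Fin n, Fin (a j)) K :=
  (segreMap K a).comp (tau K a Δ)

/-- `P_Δ`: the kernel of `σ_Δ`, regarded as an ideal of the table ring by substituting the margin
entries for the formal variables, that is, by extension along `τ_Δ`. -/
def mainPrime (K : Type*) [Field K] {n : ℕ} (a : Fin n → ℕ) (Δ : Set (Finset (Fin n))) :
    Ideal (TableRing K a) :=
  (RingHom.ker (sigma K a Δ)).map (tau K a Δ)

/-- `F` is a facet (a maximal face) of `Δ`. -/
def IsFacet {n : ℕ} (Δ : Set (Finset (Fin n))) (F : Finset (Fin n)) : Prop :=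
  Maximal (· ∈ Δ) F

/-- `Δ` is a simplicial complex each of whose facets has two elements. -/
structure IsGraph {n : ℕ} (Δ : Set (Finset (Fin n))) : Prop where
  down_closed : ∀ J ∈ Δ, ∀ J' ⊆ J, J' ∈ Δ
  card_facet : ∀ F, IsFacet Δ F → F.card = 2

/-- `Δ(j)`: the faces of `Δ` that contain `j`. -/
def facesAt {n : ℕ} (Δ : Set (Finset (Fin n))) (j : Fin n) : Set (Finset (Fin n)) :=
  {J | J ∈ Δ ∧ j ∈ J}

/-- `Γ` meets every facet (edge) of `Δ`. -/
def IsVertexCover {n : ℕ} (Δ : Set (Finset (Fin n))) (Γ : Finset (Fin n)) : Prop :=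
  ∀ F, IsFacet Δ F → ∃ j ∈ F, j ∈ Γ

end

end MarginTable

-- A minimal prime `𝔞` of `I_Δ` is the kernel of a map `f` from `R` to a field. The exchange
-- relations on an edge `{j,l}`, summed over one and then both coordinates, give `A_{jl}·A_j' =
-- A_j·A_{jl}'` (the `j`-coordinates exchanged) and `A_{jl}·A_∅ = A_j·A_l`. If `f` does not kill the
-- total `A_∅`, the second relation exhibits the images of the margins as a point of the Segre
-- parametrization, so `P_Δ ≤ 𝔞`. If it does, the vertices `j` with `L_{j} ≤ 𝔞` form a vertex cover
-- `Γ`, and for `j ∉ Γ` division by a nonzero entry of `A_j` gives `P_{Δ(j)} ≤ 𝔞`. In both cases a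
-- candidate ideal `Q` lies in `𝔞`.
--
-- For equality it suffices to find a prime `p` with `I_Δ ≤ p ≤ Q`, since minimality then forces `𝔞
-- ≤ p ≤ Q ≤ 𝔞`; primality of `Q` comes for free. To build `p`, fix a base index `o` and use as
-- coordinates on `R` the margin entries `z_k = A_S(k)`, where `S` is the set of positions at which
-- `k` differs from `o`. It is enough to impose the exchange relations on the `z_k` themselves,
-- where they are binomial. So `p` can be the kernel of a map sending each `z_k` to a monomial or to
-- zero in a monoid algebra that is a domain, and `p ≤ Q` says that monomials with equal image agree
-- modulo `Q` (`exists_prime_of_monomialMap`). The two such maps are in `exists_prime_le_mainPrime`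
-- and `exists_prime_le_coverIdeal`.

universe u

/-! ### Straightening of monomials, kernels of monomial maps, and minors under row operations. -/

namespace MarginTable
open MvPolynomial

/-- Two multisets with the same rows and the same columns have the same product under a function
that is compatible with exchanging the entries of two cells. -/
theorem prod_eq_of_exchange {V ρ κ B : Type*} [CommMonoid B] (row : V → ρ) (col : V → κ)
    (f : V → B) (hinj : ∀ v w, row v = row w → col v = col w → v = w)
    (hf : ∀ v w x, row v = row x → col w = col x →
      ∃ y, row y = row w ∧ col y = col v ∧ f v * f w = f x * f y)
    (M' : Multiset V) : ∀ M : Multiset V, M.map row = M'.map row → M.map col = M'.map col →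
      (M.map f).prod = (M'.map f).prod := by
  induction M' using Multiset.induction_on with
  | empty =>
    intro M hr _
    have : M = 0 := by simpa using hr
    rw [this]
  | cons x N ih =>
    intro M hr hc
    -- `M` contains a cell `v` in the row of `x` and a cell `w` in its column. Either they are one
    -- cell, which is then `x`, or one exchange turns the pair into `x` and some `y`.
    obtain ⟨v, hvM, hv⟩ : ∃ v ∈ M, row v = row x := by
      rw [← Multiset.mem_map, hr]; simp
    obtain ⟨w, hwM, hw⟩ : ∃ w ∈ M, col w = col x := by
      rw [← Multiset.mem_map, hc]; simp
    obtain ⟨M₁, rfl⟩ := Multiset.exists_cons_of_mem hvM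
    rcases Multiset.mem_cons.1 hwM with rfl | hwM
    · obtain rfl := hinj _ _ hv hw
      simp only [Multiset.map_cons, Multiset.cons_inj_right, Multiset.prod_cons] at hr hc ⊢
      rw [ih _ hr hc]
    · obtain ⟨M₂, rfl⟩ := Multiset.exists_cons_of_mem hwM
      obtain ⟨y, hyr, hyc, hy⟩ := hf v w x hv hw
      simp only [Multiset.map_cons, Multiset.prod_cons] at hr hc ⊢
      rw [hv, Multiset.cons_inj_right, ← hyr] at hr
      rw [hw, Multiset.cons_swap, Multiset.cons_inj_right, ← hyc] at hc
      have := ih (y ::ₘ M₂) (by simpa using hr) (by simpa using hc)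
      rw [← this, Multiset.map_cons, Multiset.prod_cons, ← mul_assoc, ← mul_assoc, hy]

theorem aeval_monomial_one_eq_multiset_prod {V K B : Type*} [CommSemiring K] [CommSemiring B]
    [Algebra K B] (f : V → B) (m : V →₀ ℕ) :
    aeval f (monomial m (1 : K)) = (m.toMultiset.map f).prod := by
  rw [aeval_monomial, map_one, one_mul, Finsupp.toMultiset_map, Finsupp.prod_toMultiset,
    Finsupp.prod_mapDomain_index (by simp) (by simp [pow_add])]

theorem multiset_prod_single {V K G : Type*} [CommSemiring K] [AddCommMonoid G] (μ : V → G)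
    (M : Multiset V) :
    (M.map fun v => AddMonoidAlgebra.single (μ v) (1 : K)).prod =
      AddMonoidAlgebra.single (M.map μ).sum 1 := by
  induction M using Multiset.induction_on with
  | empty => simp [AddMonoidAlgebra.one_def]
  | cons v M ih => simp [ih, AddMonoidAlgebra.single_mul_single]

/-- The kernel of a map sending variables to monomials or to zero. -/
theorem ker_monomialMap_le {V K G B : Type*} [CommRing K] [AddCommMonoid G] [CommRing B]
    [Algebra K B] (μ : V → G) (Z : V → Prop) [DecidablePred Z] (f : V → B)
    (hZ : ∀ v, Z v → f v = 0)
    (hf : ∀ M M' : Multiset V, (M.map μ).sum = (M'.map μ).sum →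
      (M.map f).prod = (M'.map f).prod) :
    RingHom.ker (aeval (R := K) fun v => if Z v then 0 else AddMonoidAlgebra.single (μ v) (1 : K))
      ≤ RingHom.ker (aeval (R := K) f) := by
  classical
  -- By `hf` the chosen multiset does not matter; the value 0 at exponents that no multiset attains
  -- is never used.
  let g : G → B := fun w =>
    if h : ∃ M : Multiset V, (M.map μ).sum = w then (h.choose.map f).prod else 0
  have hg : ∀ M : Multiset V, g (M.map μ).sum = (M.map f).prod := fun M => by
    have h : ∃ M' : Multiset V, (M'.map μ).sum = (M.map μ).sum := ⟨M, rfl⟩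
    simp only [g, dif_pos h]
    exact hf _ _ h.choose_spec
  let H : AddMonoidAlgebra K G →ₗ[K] B :=
    Finsupp.linearCombination K g ∘ₗ (AddMonoidAlgebra.coeffLinearEquiv K).toLinearMap
  have hH : H ∘ₗ (aeval (R := K) fun v => if Z v then 0 else
      AddMonoidAlgebra.single (μ v) (1 : K)).toLinearMap = (aeval (R := K) f).toLinearMap := by
    apply (basisMonomials V K).ext
    intro m
    simp only [coe_basisMonomials, LinearMap.comp_apply, AlgHom.toLinearMap_apply,
      aeval_monomial_one_eq_multiset_prod]
    by_cases h : ∃ v ∈ m.toMultiset, Z v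
    · obtain ⟨v, hv, hz⟩ := h
      rw [Multiset.prod_eq_zero, Multiset.prod_eq_zero, map_zero]
      · exact Multiset.mem_map.2 ⟨v, hv, hZ v hz⟩
      · exact Multiset.mem_map.2 ⟨v, hv, if_pos hz⟩
    · push Not at h
      rw [Multiset.map_congr rfl fun v hv => if_neg (h v hv), multiset_prod_single, ← hg]
      simp [H]
  intro p hp
  have := LinearMap.congr_fun hH p
  rw [RingHom.mem_ker] at hp ⊢
  simp only [LinearMap.comp_apply, AlgHom.toLinearMap_apply] at this
  rw [← this]
  erw [hp]
  simp

/-- If replacing one row by the sum of all rows makes all `2 × 2` minors vanish, then they vanish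
already before the replacement. -/
theorem minors_of_sum_row {α β B : Type*} [Fintype α] [DecidableEq α] [CommRing B]
    (o : α) (f g : α → β → B) (hg : ∀ i b, g i b = if i = o then ∑ x, f x b else f i b)
    (h : ∀ i p b d, g i b * g p d = g i d * g p b) (i p : α) (b d : β) :
    f i b * f p d = f i d * f p b := by
  -- The row operation is invertible: row `o` of `f` is row `o` of `g` minus all its other rows. The
  -- minors of `f` are then bilinear combinations of minors of `g`.
  have key : ∀ i b, f i b =
      ∑ x, (if i = o then (if x = o then 1 else -1) else if x = i then 1 else 0) * g x b := by
    intro i b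
    by_cases hi : i = o
    · subst hi
      simp only [if_true]
      rw [← Finset.add_sum_erase _ _ (Finset.mem_univ i)]
      have h1 : ∑ x ∈ Finset.univ.erase i, (if x = i then (1 : B) else -1) * g x b =
          -∑ x ∈ Finset.univ.erase i, f x b := by
        rw [← Finset.sum_neg_distrib]
        refine Finset.sum_congr rfl fun x hx => ?_
        simp [Finset.ne_of_mem_erase hx, hg]
      rw [h1, hg i b, if_pos rfl, if_pos rfl, ← Finset.add_sum_erase _ _ (Finset.mem_univ i)]
      ring
    · simp only [hi, if_false, ite_mul, one_mul, zero_mul, Finset.sum_ite_eq', Finset.mem_univ, if_true]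
      rw [hg, if_neg hi]
  rw [key i b, key p d, key i d, key p b, Finset.sum_mul_sum, Finset.sum_mul_sum]
  refine Finset.sum_congr rfl fun x _ => Finset.sum_congr rfl fun y _ => ?_
  rw [mul_mul_mul_comm, h, mul_mul_mul_comm]

end MarginTable

/-! ### Margin entries over supports as coordinates on the table ring. -/

namespace MarginTable
open MvPolynomial
noncomputable section

/-- The coordinates in which the index `k` differs from the base index `o`. -/
def indexSupport {n : ℕ} {a : Fin n → ℕ} (o k : ∀ j, Fin (a j)) : Finset (Fin n) :=
  Finset.univ.filter fun j => k j ≠ o j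

@[simp] theorem mem_indexSupport {n : ℕ} {a : Fin n → ℕ} (o k : ∀ j, Fin (a j)) (j : Fin n) :
    j ∈ indexSupport o k ↔ k j ≠ o j := by
  simp [indexSupport]

theorem indexSupport_ssubset {n : ℕ} {a : Fin n → ℕ} {o k k' : ∀ j, Fin (a j)}
    (h : ∀ j ∈ indexSupport o k, k' j = k j) (hne : k' ≠ k) :
    indexSupport o k ⊂ indexSupport o k' := by
  refine Finset.ssubset_iff_subset_ne.2 ⟨fun j hj => ?_, fun he => hne ?_⟩
  · have := h j hj
    simp_all
  · funext j
    by_cases hj : j ∈ indexSupport o k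
    · exact h j hj
    · have hj' := hj
      rw [he] at hj'
      simp only [mem_indexSupport, ne_eq, not_not] at hj hj'
      rw [hj, hj']

/-- The table whose marginal sums over the supports of the indices are prescribed. -/
def ofSupportSums {n : ℕ} {a : Fin n → ℕ} {B : Type*} [AddCommGroup B] (o : ∀ j, Fin (a j))
    (g : (∀ j, Fin (a j)) → B) (k : ∀ j, Fin (a j)) : B :=
  -- Any other index that agrees with `k` on the support of `k` has strictly larger support, so the
  -- system is triangular and is solved from full support downwards.
  g k - ∑ k' : {k' : ∀ j, Fin (a j) // k' ≠ k ∧ ∀ j ∈ indexSupport o k, k' j = k j},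
    ofSupportSums o g k'.1
termination_by n - (indexSupport o k).card
decreasing_by
  have h1 := Finset.card_lt_card (indexSupport_ssubset k'.2.2 k'.2.1)
  have h2 := Finset.card_le_univ (indexSupport o k'.1)
  simp only [Fintype.card_fin] at h2
  omega

theorem sum_ofSupportSums {n : ℕ} {a : Fin n → ℕ} {B : Type*} [AddCommGroup B]
    (o : ∀ j, Fin (a j)) (g : (∀ j, Fin (a j)) → B) (k : ∀ j, Fin (a j)) :
    ∑ k' : (∀ j, Fin (a j)) with ∀ j ∈ indexSupport o k, k' j = k j, ofSupportSums o g k' = g k := by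
  rw [← Finset.add_sum_erase _ _ (show k ∈ _ by simp), ofSupportSums]
  have : ∑ k' : {k' : ∀ j, Fin (a j) // k' ≠ k ∧ ∀ j ∈ indexSupport o k, k' j = k j},
      ofSupportSums o g k'.1 = ∑ k' ∈ (Finset.univ.filter fun k' : ∀ j, Fin (a j) =>
        ∀ j ∈ indexSupport o k, k' j = k j).erase k, ofSupportSums o g k' := by
    refine (Finset.sum_subtype _ (fun x => ?_) _).symm
    simp
  rw [this, sub_add_cancel]

/-- A table is determined by its marginal sums over the supports of the indices. -/
theorem eq_of_supportSums_eq {n : ℕ} {a : Fin n → ℕ} {B : Type*} [AddCommGroup B]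
    (o : ∀ j, Fin (a j)) (x y : (∀ j, Fin (a j)) → B)
    (h : ∀ k, ∑ k' : (∀ j, Fin (a j)) with ∀ j ∈ indexSupport o k, k' j = k j, x k' =
      ∑ k' : (∀ j, Fin (a j)) with ∀ j ∈ indexSupport o k, k' j = k j, y k') : x = y := by
  funext k
  induction hN : n - (indexSupport o k).card using Nat.strong_induction_on generalizing k with
  | _ N ih =>
    have := h k
    rw [← Finset.add_sum_erase _ _ (show k ∈ _ by simp), ← Finset.add_sum_erase _ y
      (show k ∈ _ by simp), Finset.sum_congr rfl (g := y)] at this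
    · exact add_right_cancel this
    · intro k' hk'
      simp only [Finset.mem_erase, Finset.mem_filter, Finset.mem_univ, true_and] at hk'
      refine ih _ ?_ _ rfl
      have h1 := Finset.card_lt_card (indexSupport_ssubset hk'.2 hk'.1)
      have h2 := Finset.card_le_univ (indexSupport o k')
      simp only [Fintype.card_fin] at h2
      omega

variable (K : Type*) [Field K] {n : ℕ} (a : Fin n → ℕ)

/-- The entry of the margin `A_J` of the generic table at the restriction to `J` of an index. -/
def marginEntry (J : Finset (Fin n)) (k : ∀ j, Fin (a j)) : TableRing K a :=
  margin (genericTable K a) J fun j => k j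

theorem marginEntry_eq (J : Finset (Fin n)) (k : ∀ j, Fin (a j)) :
    marginEntry K a J k = ∑ k' : (∀ j, Fin (a j)) with ∀ j ∈ J, k' j = k j, X k' := by
  simp [marginEntry, margin, genericTable]

/-- The base index `o` supplies the missing coordinates, so margins may be indexed by full indices
throughout. -/
theorem exists_restrict_eq {a : Fin n → ℕ} (o : ∀ j, Fin (a j)) (J : Finset (Fin n)) (i : ∀ j : J, Fin (a j)) :
    ∃ k : ∀ j, Fin (a j), (fun j : J => k j) = i :=
  ⟨fun j => if h : j ∈ J then i ⟨j, h⟩ else o j, by funext j; simp⟩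

variable {a}

theorem marginEntry_congr {J : Finset (Fin n)} {k k' : ∀ j, Fin (a j)} (h : ∀ j ∈ J, k j = k' j) :
    marginEntry K a J k = marginEntry K a J k' := by
  have : (fun j : J => k j) = fun j : J => k' j := funext fun j => h j j.2
  rw [marginEntry, this, marginEntry]

theorem sum_marginEntry_update {J : Finset (Fin n)} {j : Fin n} (hj : j ∈ J)
    (k : ∀ j, Fin (a j)) :
    ∑ i, marginEntry K a J (Function.update k j i) = marginEntry K a (J.erase j) k := by
  simp only [marginEntry_eq]
  rw [← Finset.sum_fiberwise _ (fun k' : ∀ j, Fin (a j) => k' j)]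
  refine Finset.sum_congr rfl fun i _ => Finset.sum_congr ?_ fun _ _ => rfl
  ext k'
  simp only [Finset.mem_filter, Finset.mem_univ, true_and, Finset.mem_erase]
  constructor
  · intro h
    refine ⟨fun l hl => ?_, ?_⟩
    · rw [h l hl.2, Function.update_of_ne hl.1]
    · rw [h j hj, Function.update_self]
  · rintro ⟨h, rfl⟩ l hl
    by_cases hlj : l = j
    · subst hlj; simp
    · rw [Function.update_of_ne hlj, h l ⟨hlj, hl⟩]

/-- Algebra maps with prescribed values on the marginal sums over the supports of the indices. -/
theorem exists_algHom_marginEntry {B : Type*} [CommRing B] [Algebra K B] (o : ∀ j, Fin (a j))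
    (g : (∀ j, Fin (a j)) → B) :
    ∃ Φ : TableRing K a →ₐ[K] B, ∀ k, Φ (marginEntry K a (indexSupport o k) k) = g k :=
  ⟨aeval (ofSupportSums o g), fun k => by
    rw [marginEntry_eq, map_sum, ← sum_ofSupportSums o g k]
    simp⟩

/-- Inverting the support sums recovers every variable of `R` as a polynomial in these margin
entries. -/
theorem aeval_marginEntry_surjective (o : ∀ j, Fin (a j)) :
    Function.Surjective (aeval (R := K) fun k => marginEntry K a (indexSupport o k) k) := by
  set θ := aeval (R := K) fun k => marginEntry K a (indexSupport o k) k
  have h : (fun k => θ (ofSupportSums o X k)) = X := by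
    refine eq_of_supportSums_eq o _ _ fun k => ?_
    rw [← map_sum, sum_ofSupportSums, ← marginEntry_eq]
    simp [θ]
  rw [← AlgHom.range_eq_top, eq_top_iff, ← adjoin_range_X, Algebra.adjoin_le_iff]
  rintro _ ⟨k, rfl⟩
  exact ⟨_, congrFun h k⟩

/-- The exchange of one coordinate in the entries of a margin. -/
def IsExchange {B : Type*} [CommRing B] (m : (∀ j, Fin (a j)) → B) (J : Finset (Fin n)) : Prop :=
  ∀ v w : ∀ j, Fin (a j), ∀ l ∈ J,
    m v * m w = m (Function.update w l (v l)) * m (Function.update v l (w l))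

theorem segreIdeal_margin_le_iff (o : ∀ j, Fin (a j)) (J : Finset (Fin n)) {B : Type*} [CommRing B]
    (f : TableRing K a →+* B) :
    segreIdeal (c := fun j : J => a j) (margin (genericTable K a) J) ≤ RingHom.ker f ↔
      IsExchange (fun k => f (marginEntry K a J k)) J := by
  have hupd : ∀ (v : ∀ j, Fin (a j)) (l : J) (x : Fin (a l)),
      Function.update (fun j : J => v j) l x = fun j : J => Function.update v l.1 x j := by
    intro v l x
    funext j
    by_cases h : j = l
    · subst h; simp
    · rw [Function.update_of_ne h, Function.update_of_ne (fun h' => h (Subtype.ext h'))]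
  rw [segreIdeal, Ideal.span_le]
  constructor
  · intro h v w l hl
    have := h ⟨fun j => v j, fun j => w j, ⟨l, hl⟩, rfl⟩
    simp only [Matrix.det_fin_two_of, SetLike.mem_coe, RingHom.mem_ker, map_sub, map_mul,
      sub_eq_zero, hupd] at this
    exact this
  · rintro h _ ⟨p, q, l, rfl⟩
    obtain ⟨v, rfl⟩ := exists_restrict_eq o J p
    obtain ⟨w, rfl⟩ := exists_restrict_eq o J q
    simp only [Matrix.det_fin_two_of, SetLike.mem_coe, RingHom.mem_ker, map_sub, map_mul,
      sub_eq_zero, hupd]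
    exact h v w l l.2

theorem independenceIdeal_le_iff (o : ∀ j, Fin (a j)) (Δ : Set (Finset (Fin n))) {B : Type*}
    [CommRing B] (f : TableRing K a →+* B) :
    independenceIdeal K a Δ ≤ RingHom.ker f ↔
      ∀ J ∈ Δ, IsExchange (fun k => f (marginEntry K a J k)) J := by
  simp only [independenceIdeal, iSup_le_iff, segreIdeal_margin_le_iff K o]

theorem marginIdeal_le_iff (o : ∀ j, Fin (a j)) (J : Finset (Fin n)) (I : Ideal (TableRing K a)) :
    marginIdeal K a J ≤ I ↔ ∀ k, marginEntry K a J k ∈ I := by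
  rw [marginIdeal, Ideal.span_le, Set.range_subset_iff]
  refine ⟨fun h k => h _, fun h i => ?_⟩
  obtain ⟨k, rfl⟩ := exists_restrict_eq o J i
  exact h k

/-- The image of a margin entry under the Segre parametrization. -/
theorem segreMap_marginEntry (J : Finset (Fin n)) (k : ∀ j, Fin (a j)) :
    segreMap K a (marginEntry K a J k) =
      ∏ j, if j ∈ J then X ⟨j, k j⟩ else ∑ i, X ⟨j, i⟩ := by
  have : ∀ j, (if j ∈ J then X ⟨j, k j⟩ else ∑ i, X ⟨j, i⟩ :
      MvPolynomial (Σ j : Fin n, Fin (a j)) K) =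
      ∑ i ∈ if j ∈ J then {k j} else Finset.univ, X ⟨j, i⟩ := by
    intro j; split_ifs <;> simp
  simp_rw [this]
  rw [Finset.prod_univ_sum, marginEntry_eq, map_sum]
  refine Finset.sum_congr ?_ fun k' _ => by simp [segreMap]
  ext k'
  simp only [Finset.mem_filter, Finset.mem_univ, true_and, Fintype.mem_piFinset]
  refine forall_congr' fun j => ?_
  split_ifs with h <;> simp [h]

/-- The formal variable of the entry of `A_J` at the restriction to `J` of an index. -/
def marginVar {Δ : Set (Finset (Fin n))} {J : Finset (Fin n)} (hJ : J ∈ Δ) (k : ∀ j, Fin (a j)) :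
    MarginRing K a Δ :=
  X ⟨⟨J, hJ⟩, fun j => k j⟩

@[simp] theorem tau_marginVar {Δ : Set (Finset (Fin n))} {J : Finset (Fin n)} (hJ : J ∈ Δ)
    (k : ∀ j, Fin (a j)) : tau K a Δ (marginVar K hJ k) = marginEntry K a J k := by
  simp [marginVar, tau, marginEntry]

@[simp] theorem sigma_marginVar {Δ : Set (Finset (Fin n))} {J : Finset (Fin n)} (hJ : J ∈ Δ)
    (k : ∀ j, Fin (a j)) : sigma K a Δ (marginVar K hJ k) =
      ∏ j, if j ∈ J then X ⟨j, k j⟩ else ∑ i, X ⟨j, i⟩ := by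
  rw [sigma, AlgHom.comp_apply, tau_marginVar, segreMap_marginEntry]

/-- If the images of the margin entries come from a point of the Segre parametrization, then `P_Δ`
is contained in the kernel. -/
theorem mainPrime_le_ker (o : ∀ j, Fin (a j)) (Δ : Set (Finset (Fin n))) {B : Type*} [CommRing B]
    [Algebra K B] (f : TableRing K a →ₐ[K] B) (η : ∀ j, Fin (a j) → B)
    (h : ∀ J ∈ Δ, ∀ k, (∏ j, if j ∈ J then η j (k j) else ∑ i, η j i) = f (marginEntry K a J k)) :
    mainPrime K a Δ ≤ RingHom.ker f := by
  have : f.comp (tau K a Δ) = (aeval fun v : Σ j : Fin n, Fin (a j) => η v.1 v.2).comp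
      (sigma K a Δ) := by
    apply algHom_ext
    rintro ⟨⟨J, hJ⟩, i⟩
    obtain ⟨k, rfl⟩ := exists_restrict_eq o J i
    change f (tau K a Δ (marginVar K hJ k)) = aeval _ (sigma K a Δ (marginVar K hJ k))
    rw [tau_marginVar, sigma_marginVar, ← h J hJ, map_prod]
    refine Finset.prod_congr rfl fun j _ => ?_
    split_ifs <;> simp
  rw [mainPrime, Ideal.map_le_iff_le_comap]
  intro s hs
  have hs' := DFunLike.congr_fun this s
  simp only [AlgHom.comp_apply] at hs'
  rw [RingHom.mem_ker] at hs
  change f (tau K a Δ s) = 0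
  rw [hs', hs, map_zero]

theorem mem_mainPrime {Δ : Set (Finset (Fin n))} {s : MarginRing K a Δ} (h : sigma K a Δ s = 0) :
    tau K a Δ s ∈ mainPrime K a Δ :=
  Ideal.mem_map_of_mem _ h

end
end MarginTable

/-! ### Exchange relations on a graph and the ideals contained in a given prime. -/

namespace MarginTable
open MvPolynomial
noncomputable section

theorem exists_isFacet_superset {n : ℕ} {Δ : Set (Finset (Fin n))} {J : Finset (Fin n)} (hJ : J ∈ Δ) :
    ∃ F, IsFacet Δ F ∧ J ⊆ F := by
  obtain ⟨F, hF, hm⟩ := (Set.toFinite Δ).exists_le_maximal hJ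
  exact ⟨F, hm, hF⟩

theorem IsGraph.face_cases {n : ℕ} {Δ : Set (Finset (Fin n))} (hΔ : IsGraph Δ)
    {J : Finset (Fin n)} (hJ : J ∈ Δ) :
    J = ∅ ∨ (∃ j, J = {j}) ∨ ∃ j l, j ≠ l ∧ J = {j, l} := by
  obtain ⟨F, hF, hJF⟩ := exists_isFacet_superset hJ
  have h1 := Finset.card_le_card hJF
  rw [hΔ.card_facet F hF] at h1
  interval_cases h : J.card
  · exact Or.inl (Finset.card_eq_zero.1 h)
  · exact Or.inr (Or.inl (Finset.card_eq_one.1 h))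
  · exact Or.inr (Or.inr (Finset.card_eq_two.1 h))

theorem IsGraph.face_cases_of_mem {n : ℕ} {Δ : Set (Finset (Fin n))} (hΔ : IsGraph Δ)
    {J : Finset (Fin n)} (hJ : J ∈ Δ) {j : Fin n} (hj : j ∈ J) :
    J = {j} ∨ ∃ l, l ≠ j ∧ J = {j, l} := by
  rcases hΔ.face_cases hJ with rfl | ⟨i, rfl⟩ | ⟨i, l, hil, rfl⟩
  · simp at hj
  · simp_all
  · rcases Finset.mem_insert.1 hj with rfl | hj
    · exact Or.inr ⟨l, hil.symm, rfl⟩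
    · obtain rfl := Finset.mem_singleton.1 hj
      exact Or.inr ⟨i, hil, Finset.pair_comm _ _⟩

variable (K : Type*) [Field K] {n : ℕ} {a : Fin n → ℕ}

/-- The exchange relations for the entries of the margin of a face follow from those for the margin
entries over the supports of the indices. -/
theorem isExchange_of_indexSupport {Δ : Set (Finset (Fin n))} (hΔ : IsGraph Δ)
    {B : Type*} [CommRing B] (o : ∀ j, Fin (a j)) (f : TableRing K a →+* B)
    {J : Finset (Fin n)} (hJ : J ∈ Δ)
    (h : ∀ v w, indexSupport o v ⊆ J → indexSupport o w ⊆ J → ∀ l ∈ J,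
      f (marginEntry K a (indexSupport o v) v) * f (marginEntry K a (indexSupport o w) w) =
      f (marginEntry K a (indexSupport o (Function.update w l (v l))) (Function.update w l (v l))) *
      f (marginEntry K a (indexSupport o (Function.update v l (w l)))
        (Function.update v l (w l)))) :
    IsExchange (fun k => f (marginEntry K a J k)) J := by
  intro v w l hl
  rcases hΔ.face_cases_of_mem hJ hl with rfl | ⟨m, hml, rfl⟩
  · dsimp only
    rw [marginEntry_congr K (k := Function.update w l (v l)) (k' := v) (by simp),
      marginEntry_congr K (k := Function.update v l (w l)) (k' := w) (by simp)]
  let e : Fin (a l) → Fin (a m) → ∀ j, Fin (a j) := fun i i' =>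
    Function.update (Function.update o l i) m i'
  have hel : ∀ i i', e i i' l = i := fun i i' => by simp [e, Function.update_of_ne hml.symm]
  have hem : ∀ i i', e i i' m = i' := fun i i' => by simp [e]
  have hsupp : ∀ i i', indexSupport o (e i i') ⊆ {l, m} := fun i i' j hj => by
    by_contra hne
    simp only [Finset.mem_insert, Finset.mem_singleton, not_or] at hne
    simp [e, Function.update_of_ne hne.1, Function.update_of_ne hne.2] at hj
  have hul : ∀ i i' x, Function.update (e i i') l x = e x i' := fun i i' x => by
    simp [e, Function.update_comm hml.symm]
  have hum : ∀ i i' x, Function.update (e i i') m x = e i x := fun i i' x => by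
    simp [e]
  -- On the edge, `f₀` is the matrix of margin entries; `f₁` replaces its row `o l` by the sum of
  -- the rows, and `f₂` then replaces column `o m` by the sum of the columns. The result consists of
  -- the entries over supports, and `minors_of_sum_row` undoes both replacements.
  let J₁ : Fin (a l) → Finset (Fin n) := fun i => if i = o l then {m} else {l, m}
  let f₀ : Fin (a l) → Fin (a m) → B := fun i i' => f (marginEntry K a {l, m} (e i i'))
  let f₁ : Fin (a l) → Fin (a m) → B := fun i i' => f (marginEntry K a (J₁ i) (e i i'))
  let f₂ : Fin (a l) → Fin (a m) → B := fun i i' =>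
    f (marginEntry K a (indexSupport o (e i i')) (e i i'))
  have h₂ : ∀ i p b d, f₂ i b * f₂ p d = f₂ i d * f₂ p b := fun i p b d => by
    have := h (e i b) (e p d) (hsupp _ _) (hsupp _ _) l (by simp)
    simpa only [hul, hel] using this
  have h21 : ∀ i i', f₂ i i' = if i' = o m then ∑ x, f₁ i x else f₁ i i' := by
    intro i i'
    have h1 : m ∈ J₁ i := by simp only [J₁]; split_ifs <;> simp
    have h2 : indexSupport o (e i i') = if i' = o m then (J₁ i).erase m else J₁ i := by
      ext j
      by_cases hj : j ∈ ({l, m} : Finset (Fin n))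
      · simp only [Finset.mem_insert, Finset.mem_singleton] at hj
        rcases hj with rfl | rfl
        · simp only [mem_indexSupport, hel, J₁]
          split_ifs <;> simp_all [hml.symm]
        · simp only [mem_indexSupport, hem, J₁]
          split_ifs <;> simp_all
      · have h3 : j ∉ indexSupport o (e i i') := fun hj' => hj (hsupp i i' hj')
        simp only [h3, false_iff]
        simp only [Finset.mem_insert, Finset.mem_singleton, not_or] at hj
        simp only [J₁]
        split_ifs <;> simp [hj.1, hj.2]
    simp only [f₂, f₁, h2]
    split_ifs with h3
    · rw [← sum_marginEntry_update K h1, map_sum]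
      simp only [hum]
    · rfl
  have h10 : ∀ i i', f₁ i i' = if i = o l then ∑ x, f₀ x i' else f₀ i i' := by
    intro i i'
    simp only [f₁, f₀, J₁]
    split_ifs with h3
    · have := sum_marginEntry_update K (J := {l, m}) (j := l) (by simp) (e i i')
      rw [Finset.erase_insert (by simpa using hml.symm)] at this
      rw [← this, map_sum]
      simp only [hul]
    · rfl
  have h₁ : ∀ i p b d, f₁ i b * f₁ p d = f₁ i d * f₁ p b := fun i p b d => by
    -- Applied to the transposes, since here a column was replaced.
    have := minors_of_sum_row (o m) (fun y x => f₁ x y) (fun y x => f₂ x y)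
      (fun y x => h21 x y) (fun b d i p => by rw [h₂ i p b d, mul_comm]) b d i p
    rw [this, mul_comm]
  have h₀ := minors_of_sum_row (o l) f₀ f₁ h10 h₁
  have hcongr : ∀ k, f (marginEntry K a {l, m} k) = f₀ (k l) (k m) := fun k => by
    simp only [f₀]
    rw [marginEntry_congr]
    simp [hel, hem]
  dsimp only
  rw [hcongr, hcongr, hcongr, hcongr]
  simp only [Function.update_self, Function.update_of_ne hml]
  exact h₀ _ _ _ _

theorem exists_algHom_field_ker_eq {R : Type u} [CommRing R] [Algebra K R] (I : Ideal R)
    [I.IsPrime] :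
    ∃ (F : Type u) (_ : Field F) (_ : Algebra K F) (f : R →ₐ[K] F), RingHom.ker f = I := by
  refine ⟨FractionRing (R ⧸ I), inferInstance, inferInstance,
    (IsScalarTower.toAlgHom K (R ⧸ I) (FractionRing (R ⧸ I))).comp (Ideal.Quotient.mkₐ K I), ?_⟩
  ext x
  rw [RingHom.mem_ker, AlgHom.comp_apply, IsScalarTower.toAlgHom_apply,
    FaithfulSMul.algebraMap_eq_zero_iff]
  exact Ideal.Quotient.eq_zero_iff_mem

section Edge
variable {K}
variable {B : Type*} [CommRing B] [Algebra K B] (f : TableRing K a →ₐ[K] B) {j l : Fin n}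

/-- Exchange coordinate `j` and sum over coordinate `l` of the second entry. -/
theorem IsExchange.mul_vertex (hjl : l ≠ j)
    (h : IsExchange (fun k => f (marginEntry K a {j, l} k)) {j, l}) (v w : ∀ j, Fin (a j)) :
    f (marginEntry K a {j, l} v) * f (marginEntry K a {j} w) =
      f (marginEntry K a {j} v) * f (marginEntry K a {j, l} (Function.update v j (w j))) := by
  have he : ({j} : Finset (Fin n)) = ({j, l} : Finset (Fin n)).erase l := by
    rw [Finset.pair_comm, Finset.erase_insert (by simpa using hjl)]
  have hl : l ∈ ({j, l} : Finset (Fin n)) := by simp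
  have h1 : f (marginEntry K a {j} v) = f (marginEntry K a {j} (Function.update w j (v j))) := by
    rw [marginEntry_congr]; simp
  rw [h1, he, ← sum_marginEntry_update K hl, ← sum_marginEntry_update K hl, map_sum, map_sum,
    Finset.mul_sum, Finset.sum_mul]
  refine Finset.sum_congr rfl fun x _ => ?_
  have := h v (Function.update w l x) j (by simp)
  dsimp only at this
  rw [this, Function.update_comm hjl.symm, Function.update_of_ne hjl.symm]

/-- Sum `IsExchange.mul_vertex` once more, over coordinate `j` of the vertex entry. -/
theorem IsExchange.mul_total (hjl : l ≠ j)
    (h : IsExchange (fun k => f (marginEntry K a {j, l} k)) {j, l}) (v w : ∀ j, Fin (a j)) :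
    f (marginEntry K a {j, l} v) * f (marginEntry K a ∅ w) =
      f (marginEntry K a {j} v) * f (marginEntry K a {l} v) := by
  have he := sum_marginEntry_update K (J := {j, l}) (j := j) (by simp) v
  rw [Finset.erase_insert (by simpa using hjl.symm)] at he
  have he' : (∅ : Finset (Fin n)) = ({j} : Finset (Fin n)).erase j := by simp
  rw [← he, he', ← sum_marginEntry_update K (J := {j}) (by simp),
    map_sum, map_sum, Finset.mul_sum, Finset.mul_sum]
  refine Finset.sum_congr rfl fun x _ => ?_
  rw [h.mul_vertex f hjl, Function.update_self]

end Edge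

section Field
variable {K}
variable {F : Type*} [Field F] [Algebra K F] (f : TableRing K a →ₐ[K] F)
  {Δ : Set (Finset (Fin n))}

theorem map_sum_marginEntry_singleton (j : Fin n) (k w : ∀ j, Fin (a j)) :
    ∑ i, f (marginEntry K a {j} (Function.update k j i)) = f (marginEntry K a ∅ w) := by
  rw [← map_sum, sum_marginEntry_update K (by simp), Finset.erase_singleton,
    marginEntry_congr K (k' := w) (by simp)]

theorem mainPrime_le_ker_of_total_ne_zero (hΔ : IsGraph Δ) (hne : Δ.Nonempty) (o : ∀ j, Fin (a j))
    (hI : independenceIdeal K a Δ ≤ RingHom.ker f) (ht : f (marginEntry K a ∅ o) ≠ 0) :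
    mainPrime K a Δ ≤ RingHom.ker f := by
  have hex := (independenceIdeal_le_iff K o Δ f.toRingHom).1 hI
  set t := f (marginEntry K a ∅ o) with htdef
  obtain ⟨j₀⟩ : Nonempty (Fin n) := by
    obtain ⟨J, hJ⟩ := hne
    obtain ⟨F, hF, -⟩ := exists_isFacet_superset hJ
    obtain ⟨j, -⟩ := Finset.card_pos.1 (by rw [hΔ.card_facet F hF]; norm_num)
    exact ⟨j⟩
  -- Take `y_j = A_j / t`, whose coordinates sum to 1, except at one vertex `j₀`, where `A_j` stays
  -- unscaled and contributes the missing factor `t`. The margin over `J` at this point is `t · ∏_{j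
  -- ∈ J} (A_j / t)`.
  refine mainPrime_le_ker K o Δ f (fun j i => f (marginEntry K a {j} (Function.update o j i)) *
    if j = j₀ then 1 else t⁻¹) fun J hJ k => ?_
  have hk : ∀ j, f (marginEntry K a {j} (Function.update o j (k j))) =
      f (marginEntry K a {j} k) := fun j => by
    rw [marginEntry_congr]; simp
  have hfac : ∀ j, (if j ∈ J then f (marginEntry K a {j} (Function.update o j (k j))) *
      (if j = j₀ then 1 else t⁻¹) else ∑ i, f (marginEntry K a {j} (Function.update o j i)) *
      if j = j₀ then 1 else t⁻¹) = (if j = j₀ then t else 1) *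
      (if j ∈ J then f (marginEntry K a {j} k) * t⁻¹ else 1) := by
    intro j
    rw [← Finset.sum_mul, map_sum_marginEntry_singleton f j o o, ← htdef, hk]
    split_ifs <;> field_simp
  rw [Finset.prod_congr rfl fun j _ => hfac j, Finset.prod_mul_distrib]
  simp only [Finset.prod_ite_eq', Finset.mem_univ, if_true, Finset.prod_ite_mem,
    Finset.univ_inter]
  rcases hΔ.face_cases hJ with rfl | ⟨j, rfl⟩ | ⟨j, l, hjl, rfl⟩
  · rw [Finset.prod_empty, mul_one, marginEntry_congr K (k := k) (k' := o) (by simp)]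
  · rw [Finset.prod_singleton]
    field_simp
  · rw [Finset.prod_pair hjl]
    have := IsExchange.mul_total f hjl.symm (hex _ hJ) k o
    rw [← htdef] at this
    field_simp
    rw [← this, mul_comm]

theorem mainPrime_facesAt_le_ker (hΔ : IsGraph Δ) (j : Fin n) (v : ∀ j, Fin (a j))
    (hI : independenceIdeal K a Δ ≤ RingHom.ker f) (hv : f (marginEntry K a {j} v) ≠ 0) :
    mainPrime K a (facesAt Δ j) ≤ RingHom.ker f := by
  have hex := (independenceIdeal_le_iff K v Δ f.toRingHom).1 hI
  -- Take `y_j = A_j`, and for `l ≠ j` the slice of `A_{jl}` at `v j` divided by the nonzero entry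
  -- `A_j(v)`. These slices sum to 1, so only vertices of the face contribute.
  refine mainPrime_le_ker K v _ f (fun l i => if l = j then
    f (marginEntry K a {l} (Function.update v l i)) else
    f (marginEntry K a {j, l} (Function.update v l i)) / f (marginEntry K a {j} v)) ?_
  rintro J ⟨hJ, hj⟩ k
  have hone : ∀ l, l ≠ j → ∑ i, (f (marginEntry K a {j, l} (Function.update v l i)) /
      f (marginEntry K a {j} v)) = 1 := fun l hl => by
    rw [← Finset.sum_div, ← map_sum, sum_marginEntry_update K (by simp), Finset.pair_comm,
      Finset.erase_insert (by simpa using hl), div_self hv]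
  have hjj : f (marginEntry K a {j} (Function.update v j (k j))) =
      f (marginEntry K a {j} k) := by
    rw [marginEntry_congr]; simp
  rcases hΔ.face_cases_of_mem hJ hj with rfl | ⟨l, hl, rfl⟩
  · rw [Finset.prod_eq_single j]
    · simp [hjj]
    · intro l _ hl
      simp only [Finset.mem_singleton, hl, if_false]
      exact hone l hl
    · simp
  · rw [Finset.prod_eq_mul j l hl.symm]
    · simp only [Finset.mem_insert, true_or, if_true, Finset.mem_singleton, or_true, hl, if_false]
      rw [hjj, mul_div_assoc', div_eq_iff hv]
      have := IsExchange.mul_vertex f hl (hex _ hJ) k v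
      change f _ * f _ = f _ * f _ at this
      rw [this, marginEntry_congr K (k := Function.update k j (v j))
        (k' := Function.update v l (k l))]
      simp [Function.update_of_ne hl, Function.update_of_ne hl.symm]
    · rintro i - ⟨hij, hil⟩
      simp only [Finset.mem_insert, Finset.mem_singleton, hij, hil, or_self, if_false]
      exact hone i hij
    · simp
    · simp

theorem isVertexCover_of_total_eq_zero (hΔ : IsGraph Δ) (o : ∀ j, Fin (a j))
    (hI : independenceIdeal K a Δ ≤ RingHom.ker f) (ht : f (marginEntry K a ∅ o) = 0)
    (Γ : Finset (Fin n)) (hΓ : ∀ j, j ∈ Γ ↔ marginIdeal K a {j} ≤ RingHom.ker f) :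
    IsVertexCover Δ Γ := by
  have hex := (independenceIdeal_le_iff K o Δ f.toRingHom).1 hI
  intro F hF
  obtain ⟨j, l, hjl, rfl⟩ := Finset.card_eq_two.1 (hΔ.card_facet F hF)
  by_contra! hcon
  have h1 := hcon j (by simp)
  have h2 := hcon l (by simp)
  simp only [hΓ, marginIdeal_le_iff K o, not_forall, RingHom.mem_ker] at h1 h2
  obtain ⟨v, hv⟩ := h1
  obtain ⟨w, hw⟩ := h2
  -- A single index carries `v` at `j` and `w` at `l`; the zero total would make the product of two
  -- nonzero vertex entries vanish.
  have := IsExchange.mul_total f hjl.symm (hex _ hF.1) (Function.update v l (w l)) o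
  rw [ht, mul_zero, marginEntry_congr K (J := {j}) (k' := v) (by simp [Function.update_of_ne hjl]),
    marginEntry_congr K (J := {l}) (k' := w) (by simp)] at this
  exact mul_ne_zero hv hw this.symm

end Field
end
end MarginTable

/-! ### Primes from monomial maps, and the prime below `P_Δ`. -/

namespace MarginTable
open MvPolynomial
noncomputable section

variable (K : Type*) [Field K] {n : ℕ} {a : Fin n → ℕ} {Δ : Set (Finset (Fin n))}

/-- A monomial map whose kernel separates `I_Δ` from `Q` yields a prime between the two. -/
theorem exists_prime_of_monomialMap (hΔ : IsGraph Δ) (o : ∀ j, Fin (a j)) {G : Type*}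
    [AddCommMonoid G] [IsDomain (AddMonoidAlgebra K G)] (μ : (∀ j, Fin (a j)) → G)
    (Z : (∀ j, Fin (a j)) → Prop) [DecidablePred Z] (Q : Ideal (TableRing K a))
    (hex : ∀ J ∈ Δ, ∀ v w, indexSupport o v ⊆ J → indexSupport o w ⊆ J → ∀ l ∈ J,
      (if Z v then 0 else AddMonoidAlgebra.single (μ v) (1 : K)) *
        (if Z w then 0 else AddMonoidAlgebra.single (μ w) (1 : K)) =
      (if Z (Function.update w l (v l)) then 0 else
        AddMonoidAlgebra.single (μ (Function.update w l (v l))) (1 : K)) *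
      (if Z (Function.update v l (w l)) then 0 else
        AddMonoidAlgebra.single (μ (Function.update v l (w l))) (1 : K)))
    (hZ : ∀ k, Z k → marginEntry K a (indexSupport o k) k ∈ Q)
    (hQ : ∀ M M' : Multiset (∀ j, Fin (a j)), (M.map μ).sum = (M'.map μ).sum →
      (M.map fun k => Ideal.Quotient.mk Q (marginEntry K a (indexSupport o k) k)).prod =
      (M'.map fun k => Ideal.Quotient.mk Q (marginEntry K a (indexSupport o k) k)).prod) :
    ∃ p : Ideal (TableRing K a), p.IsPrime ∧ independenceIdeal K a Δ ≤ p ∧ p ≤ Q := by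
  obtain ⟨Φ, hΦ⟩ := exists_algHom_marginEntry K o
    fun k => if Z k then 0 else AddMonoidAlgebra.single (μ k) (1 : K)
  refine ⟨RingHom.ker Φ, RingHom.ker_isPrime Φ, ?_, ?_⟩
  · refine (independenceIdeal_le_iff K o Δ Φ.toRingHom).2 fun J hJ => ?_
    refine isExchange_of_indexSupport K hΔ o Φ.toRingHom hJ fun v w hv hw l hl => ?_
    have h := hex J hJ v w hv hw l hl
    simp only [← hΦ] at h
    exact h
  · intro p hp
    obtain ⟨q, rfl⟩ := aeval_marginEntry_surjective K o p
    have hq : q ∈ RingHom.ker (aeval (R := K) fun k => if Z k then 0 else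
        AddMonoidAlgebra.single (μ k) (1 : K)) := by
      rw [RingHom.mem_ker] at hp ⊢
      rw [← AlgHom.comp_apply, comp_aeval] at hp
      simpa only [hΦ] using hp
    have := ker_monomialMap_le μ Z
      (fun k => Ideal.Quotient.mk Q (marginEntry K a (indexSupport o k) k))
      (fun k hk => Ideal.Quotient.eq_zero_iff_mem.2 (hZ k hk)) hQ hq
    rw [RingHom.mem_ker] at this
    rw [← Ideal.Quotient.eq_zero_iff_mem, ← this]
    change Ideal.Quotient.mkₐ K Q _ = _
    rw [← AlgHom.comp_apply, comp_aeval]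
    rfl

theorem finsupp_prod_multiset_sum {α V B : Type*} [CommMonoid B] (h : α → B) (x : V → α →₀ ℕ)
    (M : Multiset V) : ((M.map x).sum.prod fun i e => h i ^ e) =
      (M.map fun v => (x v).prod fun i e => h i ^ e).prod := by
  induction M using Multiset.induction_on with
  | empty => simp
  | cons v M ih =>
    simp only [Multiset.map_cons, Multiset.sum_cons, Multiset.prod_cons]
    rw [Finsupp.prod_add_index' (by simp) (by simp [pow_add]), ih]

theorem exists_prime_le_mainPrime (hΔ : IsGraph Δ) (o : ∀ j, Fin (a j)) :
    ∃ p : Ideal (TableRing K a), p.IsPrime ∧ independenceIdeal K a Δ ≤ p ∧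
      p ≤ mainPrime K a Δ := by
  classical
  -- Over faces the coordinates are sent to Segre monomials, the variable at `o j` standing for the
  -- sum of all `y_{j,i}`. Over nonfaces (`T`) they remain free variables.
  let Y : (∀ j, Fin (a j)) → (Σ j, Fin (a j)) →₀ ℕ := fun k =>
    if indexSupport o k ∈ Δ then ∑ j, Finsupp.single ⟨j, k j⟩ 1 else 0
  let T : (∀ j, Fin (a j)) → (∀ j, Fin (a j)) →₀ ℕ := fun k =>
    if indexSupport o k ∈ Δ then 0 else Finsupp.single k 1
  refine exists_prime_of_monomialMap K hΔ o (fun k => (Y k, T k)) (fun _ => False) _ ?_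
    (fun _ h => h.elim) ?_
  · intro J hJ v w hv hw l hl
    have hmem : ∀ {S}, S ⊆ J → S ∈ Δ := fun h => hΔ.down_closed J hJ _ h
    have hsub : ∀ v w : ∀ j, Fin (a j), indexSupport o v ⊆ J → indexSupport o (Function.update v l (w l)) ⊆ J := by
      intro v w hv j hj
      by_cases hjl : j = l
      · rwa [hjl]
      · rw [mem_indexSupport, Function.update_of_ne hjl] at hj
        exact hv (by simpa using hj)
    simp only [if_false, AddMonoidAlgebra.single_mul_single, mul_one]
    congr 1
    simp only [Y, T, if_pos (hmem hv), if_pos (hmem hw), if_pos (hmem (hsub v w hv)),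
      if_pos (hmem (hsub w v hw)), Prod.mk_add_mk, add_zero, ← Finset.sum_add_distrib]
    congr 1
    refine Finset.sum_congr rfl fun j _ => ?_
    by_cases hjl : j = l
    · subst hjl; simp
    · simp [Function.update_of_ne hjl, add_comm]
  · let s : (∀ j, Fin (a j)) → MarginRing K a Δ := fun k =>
      if h : indexSupport o k ∈ Δ then marginVar K h k else 1
    let r : (∀ j, Fin (a j)) → TableRing K a := fun k =>
      marginEntry K a (indexSupport o k) k
    -- Substituting the sum for the variable at the base index turns the monomial `Y k` into the
    -- actual value of `σ_Δ`.
    let W : (Σ j, Fin (a j)) → MvPolynomial (Σ j, Fin (a j)) K := fun x =>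
      if x.2 = o x.1 then ∑ i, X ⟨x.1, i⟩ else X x
    have hs : ∀ k, sigma K a Δ (s k) = (Y k).prod fun x e => W x ^ e := by
      intro k
      by_cases h : indexSupport o k ∈ Δ
      · simp only [s, Y, dif_pos h, if_pos h, sigma_marginVar]
        rw [← Finsupp.prod_finsetSum_index (by simp) (by simp [pow_add])]
        refine Finset.prod_congr rfl fun j _ => ?_
        rw [Finsupp.prod_single_index (by simp)]
        by_cases hk : k j = o j <;> simp [W, hk]
      · simp [s, Y, h]
    have hr : ∀ k, r k = tau K a Δ (s k) * (T k).prod fun x e => r x ^ e := by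
      intro k
      by_cases h : indexSupport o k ∈ Δ
      · simp [s, T, h, r]
      · simp [s, T, h]
    intro M M' hM
    have hfst : (M.map Y).sum = (M'.map Y).sum := by
      have := congrArg (AddMonoidHom.fst _ _) hM
      simpa only [map_multiset_sum, Multiset.map_map, Function.comp_def, AddMonoidHom.coe_fst,
        AddMonoidHom.coe_snd] using this
    have hsnd : (M.map T).sum = (M'.map T).sum := by
      have := congrArg (AddMonoidHom.snd _ _) hM
      simpa only [map_multiset_sum, Multiset.map_map, Function.comp_def, AddMonoidHom.coe_fst,
        AddMonoidHom.coe_snd] using this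
    have hprod : ∀ M : Multiset (∀ j, Fin (a j)), (M.map fun k =>
        Ideal.Quotient.mk (mainPrime K a Δ) (r k)).prod = Ideal.Quotient.mk (mainPrime K a Δ)
          (tau K a Δ (M.map s).prod * (M.map T).sum.prod fun x e => r x ^ e) := by
      intro M
      rw [finsupp_prod_multiset_sum, map_multiset_prod (tau K a Δ), Multiset.map_map,
        ← Multiset.prod_map_mul, map_multiset_prod, Multiset.map_map]
      exact congrArg Multiset.prod (Multiset.map_congr rfl fun k _ => congrArg _ (hr k))
    have hsigma : ∀ M : Multiset (∀ j, Fin (a j)), sigma K a Δ (M.map s).prod =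
        (M.map Y).sum.prod fun x e => W x ^ e := by
      intro M
      rw [finsupp_prod_multiset_sum, map_multiset_prod, Multiset.map_map]
      exact congrArg Multiset.prod (Multiset.map_congr rfl fun k _ => hs k)
    refine (hprod M).trans (Eq.trans ?_ (hprod M').symm)
    rw [hsnd, map_mul, map_mul]
    congr 1
    rw [Ideal.Quotient.eq, ← map_sub]
    apply mem_mainPrime
    rw [map_sub, hsigma, hsigma, hfst, sub_self]

end
end MarginTable

/-! ### The block structure attached to a vertex cover. -/

namespace MarginTable
open MvPolynomial
noncomputable section

variable (K : Type*) [Field K] {n : ℕ} {a : Fin n → ℕ} {Δ : Set (Finset (Fin n))}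
  {Γ : Finset (Fin n)}

theorem IsVertexCover.mem_of_edge (hΔ : IsGraph Δ) (hΓ : IsVertexCover Δ Γ) {j l : Fin n}
    (hjl : l ≠ j) (h : {j, l} ∈ Δ) (hj : j ∉ Γ) : l ∈ Γ := by
  obtain ⟨F, hF, hsub⟩ := exists_isFacet_superset h
  have : ({j, l} : Finset (Fin n)) = F := Finset.eq_of_subset_of_card_le hsub
    (by rw [hΔ.card_facet F hF, Finset.card_pair hjl.symm])
  obtain ⟨i, hi, hiΓ⟩ := hΓ F hF
  rw [← this] at hi
  rcases Finset.mem_insert.1 hi with rfl | hi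
  · exact absurd hiΓ hj
  · rwa [← Finset.mem_singleton.1 hi]

theorem IsVertexCover.sdiff_eq_singleton (hΔ : IsGraph Δ) (hΓ : IsVertexCover Δ Γ)
    {S : Finset (Fin n)} (hS : S ∈ Δ) {j : Fin n} (hj : j ∈ S) (hjΓ : j ∉ Γ) : S \ Γ = {j} := by
  rcases hΔ.face_cases_of_mem hS hj with rfl | ⟨l, hl, rfl⟩
  · ext i; simp; rintro rfl; exact hjΓ
  · have := hΓ.mem_of_edge hΔ hl hS hjΓ
    ext i
    simp only [Finset.mem_sdiff, Finset.mem_insert, Finset.mem_singleton]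
    constructor
    · rintro ⟨rfl | rfl, h⟩
      · rfl
      · exact absurd this h
    · rintro rfl
      exact ⟨Or.inl rfl, hjΓ⟩

/-- The least element of a finite set, as a set with at most one element. -/
def leastPart (S : Finset (Fin n)) : Finset (Fin n) :=
  if h : S.Nonempty then {S.min' h} else ∅

theorem exists_leastPart_eq {S : Finset (Fin n)} (h : S.Nonempty) :
    ∃ m ∈ S, leastPart S = {m} :=
  ⟨S.min' h, S.min'_mem h, by simp [leastPart, h]⟩

open Classical in
/-- The block of a margin variable with support `S`, together with the coordinates that index the
rows of this block. -/
def blockLabel (Δ : Set (Finset (Fin n))) (Γ S : Finset (Fin n)) :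
    Finset (Fin n) × Finset (Fin n) :=
  -- For a vertex cover, a face not inside `Γ` leaves it in one vertex `j`; all such faces share one
  -- block with rows indexed by coordinate `j`. An edge inside `Γ` is a block of its own, with one
  -- endpoint as row coordinate. A nonface has no row coordinate, so its variables have distinct
  -- columns. The second component separates a nonface `{j}` from the block of `j`.
  if S ∈ Δ then if (S \ Γ).Nonempty then (S \ Γ, S \ Γ) else (S, leastPart S) else (S, ∅)

theorem blockLabel_of_notMem {S : Finset (Fin n)} (h : S ∉ Δ) : blockLabel Δ Γ S = (S, ∅) := by
  simp [blockLabel, h]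

theorem blockLabel_of_subset {S : Finset (Fin n)} (h : S ∈ Δ) (hS : S ⊆ Γ) :
    blockLabel Δ Γ S = (S, leastPart S) := by
  simp [blockLabel, h, hS]

theorem blockLabel_of_sdiff {S : Finset (Fin n)} (h : S ∈ Δ) {j : Fin n} (hS : S \ Γ = {j}) :
    blockLabel Δ Γ S = ({j}, {j}) := by
  simp [blockLabel, h, hS]

theorem eq_of_blockLabel_eq_of_subset {S S' : Finset (Fin n)} (hS : S ⊆ Γ)
    (h : (blockLabel Δ Γ S').1 = S) : S' = S := by
  unfold blockLabel at h
  split_ifs at h with h1 h2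
  · obtain ⟨j, hj⟩ := h2
    have := hS (by rw [← h]; exact hj)
    exact absurd this (Finset.mem_sdiff.1 hj).2
  · exact h
  · exact h

theorem of_blockLabel_eq_singleton {S : Finset (Fin n)} {j : Fin n} (hj : j ∉ Γ)
    (h : blockLabel Δ Γ S = ({j}, {j})) : S ∈ Δ ∧ S \ Γ = {j} := by
  unfold blockLabel at h
  split_ifs at h with h1 h2
  · exact ⟨h1, congrArg Prod.fst h⟩
  · exfalso
    obtain rfl := congrArg Prod.fst h
    exact h2 ⟨j, by simpa using hj⟩
  · simp at h

/-- The index `k` with the coordinates outside `C` reset to those of `o`. -/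
def resetOutside (o : ∀ j, Fin (a j)) (C : Finset (Fin n)) (k : ∀ j, Fin (a j)) :
    ∀ j, Fin (a j) :=
  fun j => if j ∈ C then k j else o j

theorem resetOutside_eq_iff {o : ∀ j, Fin (a j)} {C : Finset (Fin n)} {k k' : ∀ j, Fin (a j)} :
    resetOutside o C k = resetOutside o C k' ↔ ∀ j ∈ C, k j = k' j := by
  refine ⟨fun h j hj => by simpa [resetOutside, hj] using congrFun h j, fun h => ?_⟩
  funext j
  by_cases hj : j ∈ C
  · simpa [resetOutside, hj] using h j hj
  · simp [resetOutside, hj]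

/-- The row of a margin variable in its block. -/
def blockRow (Δ : Set (Finset (Fin n))) (Γ : Finset (Fin n)) (o k : ∀ j, Fin (a j)) :
    (Finset (Fin n) × Finset (Fin n)) × (∀ j, Fin (a j)) :=
  (blockLabel Δ Γ (indexSupport o k), resetOutside o (blockLabel Δ Γ (indexSupport o k)).2 k)

/-- The column of a margin variable in its block. -/
def blockCol (Δ : Set (Finset (Fin n))) (Γ : Finset (Fin n)) (o k : ∀ j, Fin (a j)) :
    (Finset (Fin n) × Finset (Fin n)) × (∀ j, Fin (a j)) :=
  (blockLabel Δ Γ (indexSupport o k), resetOutside o (blockLabel Δ Γ (indexSupport o k)).2ᶜ k)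

theorem blockRow_eq_iff {o k k' : ∀ j, Fin (a j)} : blockRow Δ Γ o k = blockRow Δ Γ o k' ↔
    blockLabel Δ Γ (indexSupport o k) = blockLabel Δ Γ (indexSupport o k') ∧
      ∀ j ∈ (blockLabel Δ Γ (indexSupport o k)).2, k j = k' j := by
  rw [blockRow, blockRow, Prod.mk.injEq]
  refine and_congr_right fun h => ?_
  rw [← h, resetOutside_eq_iff]

theorem blockCol_eq_iff {o k k' : ∀ j, Fin (a j)} : blockCol Δ Γ o k = blockCol Δ Γ o k' ↔
    blockLabel Δ Γ (indexSupport o k) = blockLabel Δ Γ (indexSupport o k') ∧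
      ∀ j ∉ (blockLabel Δ Γ (indexSupport o k)).2, k j = k' j := by
  rw [blockCol, blockCol, Prod.mk.injEq]
  refine and_congr_right fun h => ?_
  rw [← h, resetOutside_eq_iff]
  simp

/-- The ideal attached to a vertex cover `Γ`. -/
def coverIdeal (a : Fin n → ℕ) (Δ : Set (Finset (Fin n))) (Γ : Finset (Fin n)) :
    Ideal (TableRing K a) :=
  independenceIdeal K a Δ ⊔ (⨆ j ∈ Γᶜ, mainPrime K a (facesAt Δ j))
    ⊔ (⨆ j ∈ Γ, marginIdeal K a {j})

theorem independenceIdeal_le_coverIdeal : independenceIdeal K a Δ ≤ coverIdeal K a Δ Γ :=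
  le_sup_left.trans le_sup_left

theorem mainPrime_facesAt_le_coverIdeal {j : Fin n} (hj : j ∉ Γ) :
    mainPrime K a (facesAt Δ j) ≤ coverIdeal K a Δ Γ :=
  (le_iSup₂_of_le (f := fun j (_ : j ∈ Γᶜ) => mainPrime K a (facesAt Δ j)) j (by simpa using hj)
    le_rfl).trans (le_sup_right.trans le_sup_left)

theorem marginIdeal_le_coverIdeal {j : Fin n} (hj : j ∈ Γ) :
    marginIdeal K a {j} ≤ coverIdeal K a Δ Γ :=
  (le_iSup₂_of_le (f := fun j (_ : j ∈ Γ) => marginIdeal K a {j}) j hj le_rfl).trans le_sup_right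

theorem marginEntry_mem_coverIdeal (hne : Γ.Nonempty) {S : Finset (Fin n)} (hS : S ⊆ Γ)
    (hcard : S.card ≤ 1) (k : ∀ j, Fin (a j)) : marginEntry K a S k ∈ coverIdeal K a Δ Γ := by
  have hmem : ∀ j ∈ Γ, ∀ k, marginEntry K a {j} k ∈ coverIdeal K a Δ Γ := fun j hj =>
    (marginIdeal_le_iff K k {j} _).1 (marginIdeal_le_coverIdeal K hj)
  rcases Finset.eq_empty_or_nonempty S with rfl | hSne
  -- The total is the sum of the entries of any one vertex margin; this is where `Γ` must be
  -- nonempty.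
  · obtain ⟨j, hj⟩ := hne
    have := sum_marginEntry_update K (Finset.mem_singleton_self j) k
    rw [Finset.erase_singleton] at this
    rw [← this]
    exact Ideal.sum_mem _ fun i _ => hmem j hj _
  · obtain ⟨j, rfl⟩ := Finset.card_eq_one.1 (le_antisymm hcard hSne.card_pos)
    exact hmem j (hS (by simp)) k

/-- Exchanging the coordinate `j` in two entries of margins over faces through `j` does not change
their product modulo `P_{Δ(j)}`. -/
theorem mul_sub_mul_mem_mainPrime_facesAt {j : Fin n} {S T : Finset (Fin n)}
    (hS : S ∈ facesAt Δ j) (hT : T ∈ facesAt Δ j) {v w x y : ∀ j, Fin (a j)}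
    (hvx : v j = x j) (hwy : w j = y j) (hwx : ∀ i ≠ j, w i = x i) (hvy : ∀ i ≠ j, v i = y i) :
    marginEntry K a S v * marginEntry K a T w - marginEntry K a T x * marginEntry K a S y ∈
      mainPrime K a (facesAt Δ j) := by
  have := mem_mainPrime K (a := a) (Δ := facesAt Δ j)
    (s := marginVar K hS v * marginVar K hT w - marginVar K hT x * marginVar K hS y) ?_
  · simpa using this
  · simp only [map_sub, map_mul, sigma_marginVar, ← Finset.prod_mul_distrib]
    rw [sub_eq_zero]
    refine Finset.prod_congr rfl fun i _ => ?_
    by_cases hij : i = j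
    · subst hij
      simp [hS.2, hT.2, hvx, hwy]
    · rw [hwx i hij, hvy i hij, mul_comm]

/-- In the block of an edge inside `Γ` the relation is a minor in `I_Δ`. In the block of `j ∉ Γ` it
may relate margins over different faces through `j`, and it lies in `P_{Δ(j)}`. Without row
coordinates it is trivial. -/
theorem exists_block_exchange (hΔ : IsGraph Δ) (hΓ : IsVertexCover Δ Γ) (o : ∀ j, Fin (a j))
    {v w x : ∀ j, Fin (a j)} (hv : blockRow Δ Γ o v = blockRow Δ Γ o x)
    (hw : blockCol Δ Γ o w = blockCol Δ Γ o x) :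
    ∃ y, blockRow Δ Γ o y = blockRow Δ Γ o w ∧ blockCol Δ Γ o y = blockCol Δ Γ o v ∧
      marginEntry K a (indexSupport o v) v * marginEntry K a (indexSupport o w) w -
        marginEntry K a (indexSupport o x) x * marginEntry K a (indexSupport o y) y ∈
        coverIdeal K a Δ Γ := by
  rw [blockRow_eq_iff] at hv
  rw [blockCol_eq_iff] at hw
  obtain ⟨hv, hvC⟩ := hv
  obtain ⟨hw, hwC⟩ := hw
  rw [hv] at hvC
  rw [hw] at hwC
  set C := (blockLabel Δ Γ (indexSupport o x)).2 with hC
  let y : ∀ j, Fin (a j) := fun j => if j ∈ C then w j else v j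
  have hyC : ∀ j ∈ C, y j = w j := fun j hj => if_pos hj
  have hyC' : ∀ j ∉ C, y j = v j := fun j hj => if_neg hj
  suffices h : indexSupport o y = indexSupport o v ∧
      marginEntry K a (indexSupport o v) v * marginEntry K a (indexSupport o w) w -
        marginEntry K a (indexSupport o x) x * marginEntry K a (indexSupport o y) y ∈
        coverIdeal K a Δ Γ by
    refine ⟨y, ?_, ?_, h.2⟩
    · rw [blockRow_eq_iff, h.1, hv, hw]
      exact ⟨rfl, hyC⟩
    · rw [blockCol_eq_iff, h.1, hv]
      exact ⟨rfl, hyC'⟩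
  have htriv : C = ∅ → indexSupport o y = indexSupport o v ∧
      marginEntry K a (indexSupport o v) v * marginEntry K a (indexSupport o w) w -
        marginEntry K a (indexSupport o x) x * marginEntry K a (indexSupport o y) y ∈
        coverIdeal K a Δ Γ := by
    intro h
    have h1 : y = v := funext fun j => hyC' j (by simp [h])
    have h2 : w = x := funext fun j => hwC j (by simp [h])
    rw [h1, h2, mul_comm, sub_self]
    exact ⟨rfl, Ideal.zero_mem _⟩
  by_cases hS : indexSupport o x ∈ Δ
  swap
  · exact htriv (by rw [hC, blockLabel_of_notMem hS])
  by_cases hSΓ : indexSupport o x ⊆ Γ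
  · have hl := blockLabel_of_subset hS hSΓ
    have hsv : indexSupport o v = indexSupport o x :=
      eq_of_blockLabel_eq_of_subset hSΓ (by rw [hv, hl])
    have hsw : indexSupport o w = indexSupport o x :=
      eq_of_blockLabel_eq_of_subset hSΓ (by rw [hw, hl])
    rcases (indexSupport o x).eq_empty_or_nonempty with he | hne
    · exact htriv (by rw [hC, hl, he]; simp [leastPart])
    obtain ⟨m, hm, hmC⟩ := exists_leastPart_eq hne
    have hC' : C = {m} := by rw [hC, hl, hmC]
    have hsy : indexSupport o y = indexSupport o v := by
      ext j
      rw [mem_indexSupport]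
      by_cases hj : j ∈ C
      · rw [hyC j hj, ← mem_indexSupport, hsw, hsv]
      · rw [hyC' j hj, mem_indexSupport]
    refine ⟨hsy, ?_⟩
    have hx : x = Function.update w m (v m) := by
      funext j
      by_cases hj : j = m
      · subst hj
        rw [Function.update_self, hvC j (by simp [hC'])]
      · rw [Function.update_of_ne hj, hwC j (by simp [hC', hj])]
    have hy : y = Function.update v m (w m) := by
      funext j
      by_cases hj : j = m
      · subst hj
        rw [Function.update_self, hyC j (by simp [hC'])]
      · rw [Function.update_of_ne hj, hyC' j (by simp [hC', hj])]
    rw [hsy, hsv, hsw]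
    have hI : independenceIdeal K a Δ ≤ RingHom.ker (Ideal.Quotient.mk (coverIdeal K a Δ Γ)) := by
      rw [Ideal.mk_ker]
      exact independenceIdeal_le_coverIdeal K
    have := (independenceIdeal_le_iff K o Δ _).1 hI _ hS v w m hm
    dsimp only at this
    rw [← hx, ← hy, ← map_mul, ← map_mul, Ideal.Quotient.eq] at this
    exact this
  · obtain ⟨j, hj, hjΓ⟩ := Finset.not_subset.1 hSΓ
    have hd := hΓ.sdiff_eq_singleton hΔ hS hj hjΓ
    have hl := blockLabel_of_sdiff hS hd
    obtain ⟨hvΔ, hvd⟩ := of_blockLabel_eq_singleton hjΓ (hv.trans hl)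
    obtain ⟨hwΔ, hwd⟩ := of_blockLabel_eq_singleton hjΓ (hw.trans hl)
    have hC' : C = {j} := by rw [hC, hl]
    have hvj : j ∈ indexSupport o v := (Finset.mem_sdiff.1 (by rw [hvd]; simp : j ∈ _ \ Γ)).1
    have hwj : j ∈ indexSupport o w := (Finset.mem_sdiff.1 (by rw [hwd]; simp : j ∈ _ \ Γ)).1
    have hsy : indexSupport o y = indexSupport o v := by
      ext i
      rw [mem_indexSupport]
      by_cases hi : i = j
      · subst hi
        rw [hyC i (by simp [hC']), ← mem_indexSupport]
        exact iff_of_true hwj hvj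
      · rw [hyC' i (by simp [hC', hi]), mem_indexSupport]
    have hsx : indexSupport o x = indexSupport o w := by
      ext i
      by_cases hi : i = j
      · subst hi
        exact iff_of_true hj hwj
      · rw [mem_indexSupport, mem_indexSupport, hwC i (by simp [hC', hi])]
    refine ⟨hsy, ?_⟩
    rw [hsy, hsx]
    exact mainPrime_facesAt_le_coverIdeal K hjΓ (mul_sub_mul_mem_mainPrime_facesAt K
      ⟨hvΔ, hvj⟩ ⟨hwΔ, hwj⟩ (hvC j (by simp [hC'])) (hyC j (by simp [hC'])).symm
      (fun i hi => hwC i (by simp [hC', hi])) fun i hi => (hyC' i (by simp [hC', hi])).symm)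

/-- The monomial of a margin variable in the variables for rows and columns. -/
def blockExponent (Δ : Set (Finset (Fin n))) (Γ : Finset (Fin n)) (o k : ∀ j, Fin (a j)) :
    ((Finset (Fin n) × Finset (Fin n)) × (∀ j, Fin (a j)) →₀ ℕ) ×
      ((Finset (Fin n) × Finset (Fin n)) × (∀ j, Fin (a j)) →₀ ℕ) :=
  (Finsupp.single (blockRow Δ Γ o k) 1, Finsupp.single (blockCol Δ Γ o k) 1)

theorem sum_map_single_eq_toFinsupp {V α : Type*} [DecidableEq α] (r : V → α) (M : Multiset V) :
    (M.map fun v => Finsupp.single (r v) 1).sum = Multiset.toFinsupp (M.map r) := by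
  induction M using Multiset.induction_on with
  | empty => simp
  | cons v M ih =>
    rw [Multiset.map_cons, Multiset.sum_cons, ih, Multiset.map_cons, ← Multiset.singleton_add,
      map_add, Multiset.toFinsupp_singleton]

/-- Exchanging the row coordinates of two variables of the same block. -/
theorem blockExponent_add {o v w x y : ∀ j, Fin (a j)} {L : Finset (Fin n) × Finset (Fin n)}
    (hv : blockLabel Δ Γ (indexSupport o v) = L) (hw : blockLabel Δ Γ (indexSupport o w) = L)
    (hx : blockLabel Δ Γ (indexSupport o x) = L) (hy : blockLabel Δ Γ (indexSupport o y) = L)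
    (hvx : ∀ j ∈ L.2, v j = x j) (hwy : ∀ j ∈ L.2, w j = y j) (hwx : ∀ j ∉ L.2, w j = x j)
    (hvy : ∀ j ∉ L.2, v j = y j) :
    blockExponent Δ Γ o v + blockExponent Δ Γ o w =
      blockExponent Δ Γ o x + blockExponent Δ Γ o y := by
  have h1 : blockRow Δ Γ o v = blockRow Δ Γ o x :=
    blockRow_eq_iff.2 ⟨by rw [hv, hx], by rwa [hv]⟩
  have h2 : blockRow Δ Γ o w = blockRow Δ Γ o y :=
    blockRow_eq_iff.2 ⟨by rw [hw, hy], by rwa [hw]⟩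
  have h3 : blockCol Δ Γ o w = blockCol Δ Γ o x :=
    blockCol_eq_iff.2 ⟨by rw [hw, hx], by rwa [hw]⟩
  have h4 : blockCol Δ Γ o v = blockCol Δ Γ o y :=
    blockCol_eq_iff.2 ⟨by rw [hv, hy], by rwa [hv]⟩
  simp only [blockExponent, h1, h2, h3, h4, Prod.mk_add_mk]
  rw [add_comm (Finsupp.single (blockCol Δ Γ o y) 1)]

end
end MarginTable

/-! ### The prime below the ideal of a vertex cover, and degenerate cases. -/

namespace MarginTable
open MvPolynomial
noncomputable section

section Cover
variable (K : Type*) [Field K] {n : ℕ} {a : Fin n → ℕ} {Δ : Set (Finset (Fin n))}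
  {Γ : Finset (Fin n)}

theorem update_indexSupport_subset {o v w : ∀ j, Fin (a j)} {J : Finset (Fin n)}
    (hv : indexSupport o v ⊆ J) {l : Fin n} (hl : l ∈ J) :
    indexSupport o (Function.update v l (w l)) ⊆ J := by
  intro j hj
  by_cases hjl : j = l
  · rwa [hjl]
  · rw [mem_indexSupport, Function.update_of_ne hjl] at hj
    exact hv (by simpa using hj)

theorem update_eq_update_of_pair {o v w : ∀ j, Fin (a j)} {j l : Fin n} (hjl : l ≠ j)
    (hv : indexSupport o v ⊆ {j, l}) (hw : indexSupport o w ⊆ {j, l}) :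
    Function.update w l (v l) = Function.update v j (w j) := by
  funext i
  by_cases hi : i = l
  · subst hi
    simp [Function.update_of_ne hjl]
  · by_cases hi' : i = j
    · subst hi'
      simp [Function.update_of_ne hi]
    · rw [Function.update_of_ne hi, Function.update_of_ne hi']
      have h : i ∉ ({j, l} : Finset (Fin n)) := by simp [hi, hi']
      have h1 : ¬ v i ≠ o i := fun h' => h (hv (by simpa using h'))
      have h2 : ¬ w i ≠ o i := fun h' => h (hw (by simpa using h'))
      rw [not_not.1 h1, not_not.1 h2]

variable (Δ Γ) in
/-- The image of a margin variable under the monomial map of a vertex cover. -/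
def blockMonomial (o k : ∀ j, Fin (a j)) : AddMonoidAlgebra K
    (((Finset (Fin n) × Finset (Fin n)) × (∀ j, Fin (a j)) →₀ ℕ) ×
      ((Finset (Fin n) × Finset (Fin n)) × (∀ j, Fin (a j)) →₀ ℕ)) :=
  if indexSupport o k ⊆ Γ ∧ (indexSupport o k).card ≤ 1 then 0 else
    AddMonoidAlgebra.single (blockExponent Δ Γ o k) 1

/-- An entry with base value at `j` has support inside `Γ` of size at most 1, hence image zero.
Exchanging `j` carries such a factor to the other side; if there is none, all four entries lie in
the block of `j`. -/
theorem blockMonomial_exchange_of_notMem (hΔ : IsGraph Δ) (hΓ : IsVertexCover Δ Γ)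
    {o v w : ∀ j, Fin (a j)} {J : Finset (Fin n)} (hJ : J ∈ Δ) (hv : indexSupport o v ⊆ J)
    (hw : indexSupport o w ⊆ J) {j : Fin n} (hj : j ∈ J) (hjΓ : j ∉ Γ) :
    blockMonomial K Δ Γ o v * blockMonomial K Δ Γ o w =
      blockMonomial K Δ Γ o (Function.update w j (v j)) *
        blockMonomial K Δ Γ o (Function.update v j (w j)) := by
  have hx : indexSupport o (Function.update w j (v j)) ⊆ J := update_indexSupport_subset hw hj
  have hy : indexSupport o (Function.update v j (w j)) ⊆ J := update_indexSupport_subset hv hj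
  have h0 : ∀ k, indexSupport o k ⊆ J → k j = o j → blockMonomial K Δ Γ o k = 0 := by
    intro k hk hkj
    have hd := hΓ.sdiff_eq_singleton hΔ hJ hj hjΓ
    have hsub : indexSupport o k ⊆ J.erase j := fun i hi => Finset.mem_erase.2
      ⟨fun h => by subst h; simp [hkj] at hi, hk hi⟩
    refine if_pos ⟨fun i hi => ?_, (Finset.card_le_card hsub).trans ?_⟩
    · by_contra hiΓ
      have h1 : i ∈ J \ Γ := Finset.mem_sdiff.2 ⟨hk hi, hiΓ⟩
      rw [hd, Finset.mem_singleton] at h1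
      exact (Finset.mem_erase.1 (hsub hi)).1 h1
    · rcases hΔ.face_cases_of_mem hJ hj with rfl | ⟨l, hl, rfl⟩
      · simp
      · rw [Finset.erase_insert (by simpa using hl.symm), Finset.card_singleton]
  have h1 : ∀ k, indexSupport o k ⊆ J → k j ≠ o j → blockMonomial K Δ Γ o k =
      AddMonoidAlgebra.single (blockExponent Δ Γ o k) 1 ∧
      blockLabel Δ Γ (indexSupport o k) = ({j}, {j}) := by
    intro k hk hkj
    have hmem : j ∈ indexSupport o k := by simpa using hkj
    have hkΔ := hΔ.down_closed J hJ _ hk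
    exact ⟨if_neg fun h => hjΓ (h.1 hmem),
      blockLabel_of_sdiff hkΔ (hΓ.sdiff_eq_singleton hΔ hkΔ hmem hjΓ)⟩
  by_cases hvj : v j = o j
  · rw [h0 v hv hvj, h0 _ hx (by simpa using hvj), zero_mul, zero_mul]
  by_cases hwj : w j = o j
  · rw [h0 w hw hwj, h0 _ hy (by simpa using hwj), mul_zero, mul_zero]
  obtain ⟨e1, l1⟩ := h1 v hv hvj
  obtain ⟨e2, l2⟩ := h1 w hw hwj
  obtain ⟨e3, l3⟩ := h1 _ hx (by simpa using hvj)
  obtain ⟨e4, l4⟩ := h1 _ hy (by simpa using hwj)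
  rw [e1, e2, e3, e4, AddMonoidAlgebra.single_mul_single, AddMonoidAlgebra.single_mul_single,
    blockExponent_add l1 l2 l3 l4]
  · simp
  · simp
  · intro i hi
    rw [Function.update_of_ne (by simpa using hi)]
  · intro i hi
    rw [Function.update_of_ne (by simpa using hi)]

/-- Only entries supported on the whole edge survive. Both sides vanish if either index has a base
value at `c` or `d`; otherwise all four entries lie in the block of the edge. -/
theorem blockMonomial_exchange_of_subset {o v w : ∀ j, Fin (a j)} {c d : Fin n} (hcd : d ≠ c)
    (hJ : {c, d} ∈ Δ) (hJΓ : {c, d} ⊆ Γ) (hc : leastPart {c, d} = {c})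
    (hv : indexSupport o v ⊆ {c, d}) (hw : indexSupport o w ⊆ {c, d}) :
    blockMonomial K Δ Γ o v * blockMonomial K Δ Γ o w =
      blockMonomial K Δ Γ o (Function.update w c (v c)) *
        blockMonomial K Δ Γ o (Function.update v c (w c)) := by
  have hx : indexSupport o (Function.update w c (v c)) ⊆ {c, d} :=
    update_indexSupport_subset hw (by simp)
  have hy : indexSupport o (Function.update v c (w c)) ⊆ {c, d} :=
    update_indexSupport_subset hv (by simp)
  have h0 : ∀ k, indexSupport o k ⊆ {c, d} → k c = o c ∨ k d = o d →
      blockMonomial K Δ Γ o k = 0 := by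
    intro k hk hkj
    refine if_pos ⟨hk.trans hJΓ, ?_⟩
    have hlt : indexSupport o k ⊂ {c, d} := by
      refine Finset.ssubset_iff_subset_ne.2 ⟨hk, fun h => ?_⟩
      have h1 : c ∈ indexSupport o k := by rw [h]; simp
      have h2 : d ∈ indexSupport o k := by rw [h]; simp
      rw [mem_indexSupport] at h1 h2
      exact hkj.elim h1 h2
    have := Finset.card_lt_card hlt
    rw [Finset.card_pair hcd.symm] at this
    omega
  have h1 : ∀ k, indexSupport o k ⊆ {c, d} → k c ≠ o c → k d ≠ o d → blockMonomial K Δ Γ o k =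
      AddMonoidAlgebra.single (blockExponent Δ Γ o k) 1 ∧
      blockLabel Δ Γ (indexSupport o k) = ({c, d}, {c}) := by
    intro k hk hkc hkd
    have : indexSupport o k = {c, d} := by
      refine Finset.Subset.antisymm hk fun i hi => ?_
      simp only [Finset.mem_insert, Finset.mem_singleton] at hi
      rcases hi with rfl | rfl <;> simpa
    rw [this, blockLabel_of_subset hJ hJΓ, hc]
    refine ⟨if_neg fun h => ?_, rfl⟩
    rw [this, Finset.card_pair hcd.symm] at h
    omega
  by_cases hvc : v c = o c
  · rw [h0 v hv (Or.inl hvc), h0 _ hx (Or.inl (by simpa using hvc)), zero_mul, zero_mul]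
  by_cases hwc : w c = o c
  · rw [h0 w hw (Or.inl hwc), h0 _ hy (Or.inl (by simpa using hwc)), mul_zero, mul_zero]
  by_cases hvd : v d = o d
  · rw [h0 v hv (Or.inr hvd), h0 _ hy (Or.inr (by simpa [Function.update_of_ne hcd] using hvd)),
      zero_mul, mul_zero]
  by_cases hwd : w d = o d
  · rw [h0 w hw (Or.inr hwd), h0 _ hx (Or.inr (by simpa [Function.update_of_ne hcd] using hwd)),
      zero_mul, mul_zero]
  obtain ⟨e1, l1⟩ := h1 v hv hvc hvd
  obtain ⟨e2, l2⟩ := h1 w hw hwc hwd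
  obtain ⟨e3, l3⟩ := h1 _ hx (by simpa using hvc) (by simpa [Function.update_of_ne hcd] using hwd)
  obtain ⟨e4, l4⟩ := h1 _ hy (by simpa using hwc) (by simpa [Function.update_of_ne hcd] using hvd)
  rw [e1, e2, e3, e4, AddMonoidAlgebra.single_mul_single, AddMonoidAlgebra.single_mul_single,
    blockExponent_add l1 l2 l3 l4]
  · simp
  · simp
  · intro i hi
    rw [Function.update_of_ne (by simpa using hi)]
  · intro i hi
    rw [Function.update_of_ne (by simpa using hi)]

theorem blockMonomial_exchange (hΔ : IsGraph Δ) (hΓ : IsVertexCover Δ Γ)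
    {o v w : ∀ j, Fin (a j)} {J : Finset (Fin n)} (hJ : J ∈ Δ) (hv : indexSupport o v ⊆ J)
    (hw : indexSupport o w ⊆ J) {l : Fin n} (hl : l ∈ J) :
    blockMonomial K Δ Γ o v * blockMonomial K Δ Γ o w =
      blockMonomial K Δ Γ o (Function.update w l (v l)) *
        blockMonomial K Δ Γ o (Function.update v l (w l)) := by
  by_cases hlΓ : l ∉ Γ
  · exact blockMonomial_exchange_of_notMem K hΔ hΓ hJ hv hw hl hlΓ
  rw [not_not] at hlΓ
  rcases hΔ.face_cases_of_mem hJ hl with rfl | ⟨m, hm, rfl⟩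
  · have hvw : ∀ v w : ∀ j, Fin (a j), indexSupport o v ⊆ {l} → indexSupport o w ⊆ {l} →
        Function.update w l (v l) = v := by
      intro v w hv hw
      funext i
      by_cases hi : i = l
      · subst hi; simp
      · have h1 : ¬ v i ≠ o i := fun h => hi (by simpa using hv (by simpa using h))
        have h2 : ¬ w i ≠ o i := fun h => hi (by simpa using hw (by simpa using h))
        rw [Function.update_of_ne hi, not_not.1 h1, not_not.1 h2]
    rw [hvw v w hv hw, hvw w v hw hv]
  -- For indices supported on an edge, exchanging one endpoint or the other gives the same unordered
  -- pair. The exchanged endpoint can therefore be chosen to be the row coordinate of the block.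
  · rw [update_eq_update_of_pair (o := o) (j := m) hm.symm (by rwa [Finset.pair_comm])
        (by rwa [Finset.pair_comm]), update_eq_update_of_pair (o := o) (v := w) (j := m) hm.symm
        (by rwa [Finset.pair_comm]) (by rwa [Finset.pair_comm]), mul_comm (blockMonomial K Δ Γ o
        (Function.update v m (w m)))]
    by_cases hmΓ : m ∉ Γ
    · exact blockMonomial_exchange_of_notMem K hΔ hΓ hJ hv hw (by simp) hmΓ
    rw [not_not] at hmΓ
    have hsub : {l, m} ⊆ Γ := by
      intro i hi
      simp only [Finset.mem_insert, Finset.mem_singleton] at hi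
      rcases hi with rfl | rfl <;> assumption
    obtain ⟨c, hc, hcl⟩ := exists_leastPart_eq (S := {l, m}) ⟨l, by simp⟩
    simp only [Finset.mem_insert, Finset.mem_singleton] at hc
    rcases hc with rfl | rfl
    · rw [blockMonomial_exchange_of_subset K hm hJ hsub hcl hv hw,
        update_eq_update_of_pair hm hv hw, update_eq_update_of_pair hm hw hv, mul_comm]
    · rw [Finset.pair_comm] at hJ hsub hcl hv hw
      exact blockMonomial_exchange_of_subset K hm.symm hJ hsub hcl hv hw

/-- Each surviving coordinate maps to a row variable times a column variable, so equal images mean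
equal multisets of rows and of columns. `prod_eq_of_exchange` then passes between the monomials by
block exchanges, valid modulo the cover ideal. -/
theorem exists_prime_le_coverIdeal (hΔ : IsGraph Δ) (hΓ : IsVertexCover Δ Γ) (hne : Γ.Nonempty)
    (o : ∀ j, Fin (a j)) :
    ∃ p : Ideal (TableRing K a), p.IsPrime ∧ independenceIdeal K a Δ ≤ p ∧
      p ≤ coverIdeal K a Δ Γ := by
  classical
  refine exists_prime_of_monomialMap K hΔ o (blockExponent Δ Γ o)
    (fun k => indexSupport o k ⊆ Γ ∧ (indexSupport o k).card ≤ 1) _ ?_ ?_ ?_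
  · intro J hJ v w hv hw l hl
    have := blockMonomial_exchange K hΔ hΓ hJ hv hw hl
    simp only [blockMonomial] at this
    convert this
  · exact fun k hk => marginEntry_mem_coverIdeal K hne hk.1 hk.2 k
  · intro M M' hM
    have hrow : M.map (blockRow Δ Γ o) = M'.map (blockRow Δ Γ o) := by
      have := congrArg (AddMonoidHom.fst _ _) hM
      simp only [map_multiset_sum, Multiset.map_map, Function.comp_def, blockExponent,
        AddMonoidHom.coe_fst, sum_map_single_eq_toFinsupp] at this
      exact Multiset.toFinsupp.injective this
    have hcol : M.map (blockCol Δ Γ o) = M'.map (blockCol Δ Γ o) := by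
      have := congrArg (AddMonoidHom.snd _ _) hM
      simp only [map_multiset_sum, Multiset.map_map, Function.comp_def, blockExponent,
        AddMonoidHom.coe_snd, sum_map_single_eq_toFinsupp] at this
      exact Multiset.toFinsupp.injective this
    refine prod_eq_of_exchange (blockRow Δ Γ o) (blockCol Δ Γ o) _ ?_ ?_ M' M hrow hcol
    · intro v w hr hc
      rw [blockRow_eq_iff] at hr
      rw [blockCol_eq_iff] at hc
      funext j
      by_cases hj : j ∈ (blockLabel Δ Γ (indexSupport o v)).2
      · exact hr.2 j hj
      · exact hc.2 j hj
    · intro v w x hv hw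
      obtain ⟨y, h1, h2, h3⟩ := exists_block_exchange K hΔ hΓ o hv hw
      refine ⟨y, h1, h2, ?_⟩
      rw [← map_mul, ← map_mul, Ideal.Quotient.eq]
      exact h3

end Cover

section Degenerate
variable (K : Type*) [Field K] {n : ℕ} {a : Fin n → ℕ} {Δ : Set (Finset (Fin n))}

theorem mainPrime_empty : mainPrime K a ∅ = ⊥ := by
  rw [eq_bot_iff, mainPrime, Ideal.map_le_iff_le_comap]
  intro s hs
  rw [RingHom.mem_ker, eq_C_of_isEmpty s] at hs
  rw [eq_C_of_isEmpty s]
  have : coeff 0 s = 0 := by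
    rw [sigma, AlgHom.comp_apply, tau, aeval_C, algebraMap_eq, segreMap, aeval_C,
      algebraMap_eq, C_eq_zero] at hs
    exact hs
  rw [this]
  simp

theorem mainPrime_of_isEmpty [IsEmpty (∀ j, Fin (a j))] : mainPrime K a Δ = ⊥ := by
  rw [eq_bot_iff, mainPrime, Ideal.map_le_iff_le_comap]
  intro s hs
  rw [RingHom.mem_ker, sigma, AlgHom.comp_apply, eq_C_of_isEmpty (tau K a Δ s), segreMap,
    aeval_C, algebraMap_eq, C_eq_zero] at hs
  rw [Ideal.mem_comap, eq_C_of_isEmpty (tau K a Δ s), hs]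
  simp

theorem eq_bot_of_isEmpty {σ : Type*} [IsEmpty σ] (I : Ideal (MvPolynomial σ K)) [I.IsPrime] :
    I = ⊥ := by
  rw [eq_bot_iff]
  intro x hx
  rw [eq_C_of_isEmpty x] at hx ⊢
  by_contra h
  have h' : coeff 0 x ≠ 0 := fun h' => h (by simp [h'])
  exact Ideal.IsPrime.ne_top ‹_› (Ideal.eq_top_of_isUnit_mem _ hx (h'.isUnit.map C))

end Degenerate

end
end MarginTable

/-! ### The classification of minimal primes. -/

theorem mainTheorem9 (K : Type*) [Field K] {n : ℕ} (a : Fin n → ℕ)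
    (Δ : Set (Finset (Fin n))) (hΔ : MarginTable.IsGraph Δ)
    (𝔞 : Ideal (MarginTable.TableRing K a))
    (h𝔞 : 𝔞 ∈ (MarginTable.independenceIdeal K a Δ).minimalPrimes) :
    𝔞 = MarginTable.mainPrime K a Δ ∨
      ∃ Γ : Finset (Fin n), MarginTable.IsVertexCover Δ Γ ∧
        𝔞 = MarginTable.independenceIdeal K a Δ
            ⊔ (⨆ j ∈ Γᶜ, MarginTable.mainPrime K a (MarginTable.facesAt Δ j))
            ⊔ (⨆ j ∈ Γ, MarginTable.marginIdeal K a {j}) := by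
  classical
  have hprime : 𝔞.IsPrime := h𝔞.1.1
  have hI := h𝔞.1.2
  have hmin : ∀ Q : Ideal (MarginTable.TableRing K a), Q ≤ 𝔞 →
      (∃ p : Ideal (MarginTable.TableRing K a), p.IsPrime ∧
        MarginTable.independenceIdeal K a Δ ≤ p ∧ p ≤ Q) → 𝔞 = Q := by
    rintro Q hQ ⟨p, hp, hIp, hpQ⟩
    exact le_antisymm ((h𝔞.2 ⟨hp, hIp⟩ (hpQ.trans hQ)).trans hpQ) hQ
  -- Some `a j` may be 0, in which case `R` is the field `K` and both ideals are zero; otherwise a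
  -- base index exists.
  rcases isEmpty_or_nonempty (∀ j, Fin (a j)) with he | ⟨⟨o⟩⟩
  · left
    rw [MarginTable.mainPrime_of_isEmpty, MarginTable.eq_bot_of_isEmpty K 𝔞]
  rcases Δ.eq_empty_or_nonempty with rfl | hne
  · left
    refine hmin _ ?_ (MarginTable.exists_prime_le_mainPrime K hΔ o)
    rw [MarginTable.mainPrime_empty]
    exact bot_le
  obtain ⟨F, _, _, f, hf⟩ := MarginTable.exists_algHom_field_ker_eq K 𝔞
  have hIf : MarginTable.independenceIdeal K a Δ ≤ RingHom.ker f := hf ▸ hI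
  by_cases ht : f (MarginTable.marginEntry K a ∅ o) = 0
  · right
    -- The largest set of vertices whose ideals `L_{j}` lie in `𝔞`: the total being zero makes it a
    -- cover, and its complement has nonzero entries to divide by.
    let Γ : Finset (Fin n) :=
      Finset.univ.filter fun j => MarginTable.marginIdeal K a {j} ≤ RingHom.ker f
    have hΓ : ∀ j, j ∈ Γ ↔ MarginTable.marginIdeal K a {j} ≤ RingHom.ker f := by simp [Γ]
    have hcov := MarginTable.isVertexCover_of_total_eq_zero f hΔ o hIf ht Γ hΓ
    have hΓne : Γ.Nonempty := by
      obtain ⟨J, hJ⟩ := hne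
      obtain ⟨E, hE, -⟩ := MarginTable.exists_isFacet_superset hJ
      obtain ⟨j, -, hj⟩ := hcov E hE
      exact ⟨j, hj⟩
    refine ⟨Γ, hcov, hmin _ ?_ (MarginTable.exists_prime_le_coverIdeal K hΔ hcov hΓne o)⟩
    refine sup_le (sup_le hI (iSup₂_le fun j hj => ?_)) (iSup₂_le fun j hj => ?_)
    · rw [Finset.mem_compl, hΓ, MarginTable.marginIdeal_le_iff K o, not_forall] at hj
      obtain ⟨v, hv⟩ := hj
      rw [← hf]
      exact MarginTable.mainPrime_facesAt_le_ker f hΔ j v hIf hv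
    · rw [← hf]
      exact (hΓ j).1 hj
  · left
    refine hmin _ ?_ (MarginTable.exists_prime_le_mainPrime K hΔ o)
    rw [← hf]
    exact MarginTable.mainPrime_le_ker_of_total_ne_zero f hΔ hne o hIf ht
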